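/- Let $D\subseteq\mathbb R$ be a domain (an open interval), $x^*\in D$, $m\ge 2$ an integer, and let $J\in C^m(D;\mathbb R)$. Suppose that there are constants $\alpha_1,\alpha_2>0$ and $\beta_{11},\beta_{12},\beta_{21},\beta_{22}\ge 0$, with $\beta_{21}=0$ if $m=2$, such that for all $x\in D$ $$\alpha_1|x-x^*|^m\le J(x)-J(x^*)\le\alpha_2|x-x^*|^m,$$ $$J^{(1)}(x)(x-x^*)\ge\beta_{11}|x-x^*|^m,\qquad |J^{(1)}(x)|\le\beta_{12}|x-x^*|^{m-1},$$ $$J^{(3)}(x)(x-x^*)\ge\beta_{21}|x-x^*|^{m-2},\qquad |J^{(3)}(x)|\le\beta_{22}.$$ Consider the system $$\dot x=\sum_{k=1}^4 g_k(J(x))\,u_k^\varepsilon(t),\qquad \varepsilon>0, \tag{1}$$ with the inputs $$u_1^\varepsilon(t)=\varepsilon^{-1/2}\,2\sqrt{\kappa_{12}\pi}\,\cos(2\kappa_{12}\pi t/\varepsilon),\qquad u_2^\varepsilon(t)=\varepsilon^{-1/2}\,2\sqrt{\kappa_{12}\pi}\,\sin(2\kappa_{12}\pi t/\varepsilon),$$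 $$u_3^\varepsilon(t)=\varepsilon^{-3/4}\,6(2\kappa_{1222}\pi)^{3/4}\sin(6\kappa_{1222}\pi t/\varepsilon),\qquad u_4^\varepsilon(t)=\varepsilon^{-3/4}\,2(2\kappa_{1222}\pi)^{3/4}\cos(2\kappa_{1222}\pi t/\varepsilon),$$ where $\kappa_{12},\kappa_{1222}$ are positive integers. Assume that neither the pair $(\kappa_{12},\kappa_{1222})$ nor the pair $(\kappa_{12},3\kappa_{1222})$ has a resonance of order up to $4$ (a pair $(a,b)$ has no resonance of order up to $4$ if the only integers $p,q$ with $|p|+|q|\le 4$ and $pa+qb=0$ are $p=q=0$), and that there is no resonance $\kappa_{12}=\kappa_{1222}+3\kappa_{1222}$ between the three frequencies. Let $g_k\circ J\in C^4(D;\mathbb R)$ for $k=1,2,3,4$, and suppose that for some $\gamma_1,\gamma_3\ge 0$ and all $x\in D$ $$[g_1\circ J,g_2\circ J](x)=-\gamma_1J^{(1)}(x),\qquad \big[\big[[g_3\circ J,g_4\circ J],g_4\circ J\big],g_4\circ J\big](x)=-\gamma_3J^{(3)}(x),$$ where $[f,g]=g'f-f'g$. Suppose that $\gamma_1\beta_{11}+\gamma_3\beta_{21}>0$,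 and that $\gamma_3>0$ if $m=4$. Then $x^*$ is practically exponentially stable for (1) if $m=2$ or $m=4$, and practically asymptotically stable for (1) if $m>4$. Here $B_r=\{x:|x-x^*|<r\}$, $\overline{B_r}$ is its closure, and solutions are understood in $D$. Practical exponential stability means: there are $c,\lambda>0$ such that for every $\delta>0$ with $\overline{B_\delta}\subseteq D$ and every $\rho>0$ there is $\bar\varepsilon>0$ such that for all $\varepsilon\in(0,\bar\varepsilon)$, $t_0\ge0$ and $x^0\in B_\delta$, a solution with $x(t_0)=x^0$ exists for all $t\ge t_0$, and every solution with $x(t_0)=x^0$ satisfies $|x(t)-x^*|\le c|x^0-x^*|e^{-\lambda(t-t_0)}+\rho$ as long as it is defined. Practical asymptotic stability means: (i) for every $\rho>0$ there are $\delta,\bar\varepsilon>0$ such that for all $\varepsilon\in(0,\bar\varepsilon)$, $t_0\ge0$ and $x^0\in B_\delta$, a solution with $x(t_0)=x^0$ exists for all $t\ge t_0$, and every such solution stays in $B_\rho$; and (ii) for every $\delta>0$ with $\overline{B_\delta}\subseteq D$ and every $\rho>0$ there are $\tau\ge0$ and $\bar\varepsilon>0$ such that for all $\varepsilon\in(0,\bar\varepsilon)$,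 $t_0\ge0$ and $x^0\in B_\delta$, a solution with $x(t_0)=x^0$ exists for all $t\ge t_0$, and every such solution lies in $B_\rho$ for $t\ge t_0+\tau$. -/

import Mathlib

noncomputable section

/-- The pair of frequencies `(a, b)` has no resonance of order up to `N`:
the only integers `p, q` with `|p| + |q| ≤ N` and `p a + q b = 0` are `p = q = 0`. -/
def NoResonance (N : ℤ) (a b : ℤ) : Prop :=
  ∀ p q : ℤ, |p| + |q| ≤ N → p * a + q * b = 0 → p = 0 ∧ q = 0

/-- The dither `v₁¹²(τ) = 2 √(κ π) cos (2 κ π τ)`. -/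
def ditherFst12 (κ : ℤ) (τ : ℝ) : ℝ :=
  2 * Real.sqrt (κ * Real.pi) * Real.cos (2 * κ * Real.pi * τ)

/-- The dither `v₂¹²(τ) = 2 √(κ π) sin (2 κ π τ)`. -/
def ditherSnd12 (κ : ℤ) (τ : ℝ) : ℝ :=
  2 * Real.sqrt (κ * Real.pi) * Real.sin (2 * κ * Real.pi * τ)

/-- The dither `v₁¹²²²(τ) = 6 (2 κ π)^{3/4} sin (6 κ π τ)`. -/
def ditherFst1222 (κ : ℤ) (τ : ℝ) : ℝ :=
  6 * (2 * κ * Real.pi) ^ (3 / 4 : ℝ) * Real.sin (6 * κ * Real.pi * τ)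

/-- The dither `v₂¹²²²(τ) = 2 (2 κ π)^{3/4} cos (2 κ π τ)`. -/
def ditherSnd1222 (κ : ℤ) (τ : ℝ) : ℝ :=
  2 * (2 * κ * Real.pi) ^ (3 / 4 : ℝ) * Real.cos (2 * κ * Real.pi * τ)

/-- The four inputs `u_k^ε(t)`, with indices shifted to `0, 1, 2, 3`. -/
def input (κ₁₂ κ₁₂₂₂ : ℤ) (ε t : ℝ) : Fin 4 → ℝ :=
  ![ε ^ (-(1 / 2) : ℝ) * ditherFst12 κ₁₂ (t / ε),
    ε ^ (-(1 / 2) : ℝ) * ditherSnd12 κ₁₂ (t / ε),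
    ε ^ (-(3 / 4) : ℝ) * ditherFst1222 κ₁₂₂₂ (t / ε),
    ε ^ (-(3 / 4) : ℝ) * ditherSnd1222 κ₁₂₂₂ (t / ε)]

/-- The right-hand side `∑ g_k(J(x)) u_k^ε(t)` of the extremum seeking system. -/
def esField (g : Fin 4 → ℝ → ℝ) (J : ℝ → ℝ) (κ₁₂ κ₁₂₂₂ : ℤ) (ε t x : ℝ) : ℝ :=
  ∑ k : Fin 4, g k (J x) * input κ₁₂ κ₁₂₂₂ ε t k

/-- A function that behaves near `xs` like a polynomial of degree `m`: the assumption on the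
cost `J` on the set `D`, with all its constants. -/
structure PolynomialLike (J : ℝ → ℝ) (D : Set ℝ) (xs : ℝ) (m : ℕ)
    (α₁ α₂ β₁₁ β₁₂ β₂₁ β₂₂ : ℝ) : Prop where
  two_le : 2 ≤ m
  contDiffOn : ContDiffOn ℝ m J D
  α₁_pos : 0 < α₁
  α₂_pos : 0 < α₂
  β₁₁_nonneg : 0 ≤ β₁₁
  β₁₂_nonneg : 0 ≤ β₁₂
  β₂₁_nonneg : 0 ≤ β₂₁
  β₂₂_nonneg : 0 ≤ β₂₂
  β₂₁_eq_zero : m = 2 → β₂₁ = 0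
  lower : ∀ x ∈ D, α₁ * |x - xs| ^ m ≤ J x - J xs
  upper : ∀ x ∈ D, J x - J xs ≤ α₂ * |x - xs| ^ m
  deriv_lower : ∀ x ∈ D, β₁₁ * |x - xs| ^ m ≤ iteratedDeriv 1 J x * (x - xs)
  deriv_upper : ∀ x ∈ D, |iteratedDeriv 1 J x| ≤ β₁₂ * |x - xs| ^ (m - 1)
  deriv3_lower : ∀ x ∈ D, β₂₁ * |x - xs| ^ (m - 2) ≤ iteratedDeriv 3 J x * (x - xs)
  deriv3_upper : ∀ x ∈ D, |iteratedDeriv 3 J x| ≤ β₂₂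

/-- `x` is a solution in `D` of `ẋ = f(t, x)` on the time interval `I`. -/
def IsSolutionOn (f : ℝ → ℝ → ℝ) (D I : Set ℝ) (x : ℝ → ℝ) : Prop :=
  ∀ t ∈ I, x t ∈ D ∧ HasDerivWithinAt x (f t (x t)) I t

/-- The initial value problem `ẋ = f(t, x)`, `x(t₀) = x₀` has a solution in `D` for all
`t ≥ t₀`, and every solution in `D`, on whatever interval `[t₀, T]`, has the property `P` at
all times. -/
def SolutionsSatisfy (f : ℝ → ℝ → ℝ) (D : Set ℝ) (t₀ x₀ : ℝ) (P : ℝ → ℝ → Prop) : Prop :=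
  (∃ x : ℝ → ℝ, x t₀ = x₀ ∧ IsSolutionOn f D (Set.Ici t₀) x) ∧
    ∀ T ≥ t₀, ∀ x : ℝ → ℝ, x t₀ = x₀ → IsSolutionOn f D (Set.Icc t₀ T) x →
      ∀ t ∈ Set.Icc t₀ T, P t (x t)

/-- Practical uniform stability of the point `xs` for the family `ẋ = F ε t x`. -/
def PracticallyStable (F : ℝ → ℝ → ℝ → ℝ) (D : Set ℝ) (xs : ℝ) : Prop :=
  ∀ ρ > 0, ∃ δ > 0, ∃ εbar > 0, ∀ ε ∈ Set.Ioo 0 εbar, ∀ t₀ ≥ 0, ∀ x₀ ∈ Metric.ball xs δ,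
    SolutionsSatisfy (F ε) D t₀ x₀ fun _ y => y ∈ Metric.ball xs ρ

/-- Practical uniform attractivity of the point `xs` for the family `ẋ = F ε t x`, from every
ball around `xs` whose closure lies in `D`. -/
def PracticallyAttractive (F : ℝ → ℝ → ℝ → ℝ) (D : Set ℝ) (xs : ℝ) : Prop :=
  ∀ δ > 0, Metric.closedBall xs δ ⊆ D → ∀ ρ > 0, ∃ τ ≥ 0, ∃ εbar > 0,
    ∀ ε ∈ Set.Ioo 0 εbar, ∀ t₀ ≥ 0, ∀ x₀ ∈ Metric.ball xs δ,
      SolutionsSatisfy (F ε) D t₀ x₀ fun t y => t₀ + τ ≤ t → y ∈ Metric.ball xs ρ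

/-- Practical (uniform) asymptotic stability. -/
def PracticallyAsymptoticallyStable (F : ℝ → ℝ → ℝ → ℝ) (D : Set ℝ) (xs : ℝ) : Prop :=
  PracticallyStable F D xs ∧ PracticallyAttractive F D xs

/-- Practical (uniform) exponential stability: an exponential decay estimate up to an error `ρ`,
for solutions from any ball whose closure lies in `D`, once `ε` is small. -/
def PracticallyExponentiallyStable (F : ℝ → ℝ → ℝ → ℝ) (D : Set ℝ) (xs : ℝ) : Prop :=
  ∃ c > 0, ∃ rate > 0, ∀ δ > 0, Metric.closedBall xs δ ⊆ D → ∀ ρ > 0, ∃ εbar > 0,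
    ∀ ε ∈ Set.Ioo 0 εbar, ∀ t₀ ≥ 0, ∀ x₀ ∈ Metric.ball xs δ,
      SolutionsSatisfy (F ε) D t₀ x₀ fun t y =>
        |y - xs| ≤ c * |x₀ - xs| * Real.exp (-rate * (t - t₀)) + ρ

end

/-!
The theorem is a fourth-order averaging argument followed by a Lyapunov estimate for the averaged
scalar equation.

*Averaging.* With `η = ε ^ (1 / 4)` and the fast time `τ = t / ε` the system reads
`dx/dτ = ∑ η ^ wᵢ vᵢ(τ) fᵢ(x)`, where `fᵢ = gᵢ ∘ J` and the weights `wᵢ` are `2, 2, 1, 1`. To every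
word in the four letters belong an iterated Lie derivative of the identity (`wordField`) and a
trigonometric polynomial (`TrigPoly.wordCoeff`), obtained by repeatedly multiplying by a dither,
removing the mean and integrating. Their alternating sum over the words of weight at most `4`
(`expansion`) is a change of variables `z = x + O(η)`. In its derivative along a solution
everything cancels except the removed means and the words of weight at least `5`
(`hasDerivWithinAt_expansion`). The latter contribute `O(η ^ 5)`, since a word of length five
involves no more than four derivatives of the `fᵢ`.

*The means.* Up to weight `4` almost all means vanish, either because the integrand is odd in time
or because the non-resonance conditions exclude the frequency zero. The six remaining ones are
`∓ 1` for the words of `[f₀, f₁]` and `-1, 3, -3, 1` for those of `[[[f₂, f₃], f₃], f₃]`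
(`TrigPoly.wordMean_eq_bracketCoeff`). Hence `ż = F(x) + O(η)` with
`F = -γ₁ J' - γ₃ J'''` (`isAveragedBy_esField`).

*Stability.* If `(x - x*) F(x) ≤ -λ ((x - x*)² - r²)` on `D`, comparison for `(z - x*)²` shows that
`|x - x*| ≤ |x⁰ - x*| exp (-λ (t - t₀)) + r + o(1)` as long as `x` stays in a fixed compact ball
(`IsAveragedBy.exists_norm_sub_le`). This bound keeps `x` in that ball, which also yields existence
for all times (`IsAveragedBy.solutionsSatisfy`). For `m = 2` the inequality holds with `r = 0`. For
`m = 4` it does too, because the two-sided quartic bound on `J` and the sign of `J'''` force the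
fourth derivative at `x*` to be positive (`PolynomialLike.exists_third_deriv_lower`). For `m > 4`
it holds with every `r > 0` and a rate `λ` depending on `r`.
-/

/-! ### Formal trigonometric polynomials -/

/-- Complex trigonometric polynomials of period `1`, as formal sums: `single n c` stands for
`τ ↦ c exp (2 π i n τ)`. -/
abbrev TrigPoly : Type := AddMonoidAlgebra ℂ ℤ

namespace TrigPoly

open AddMonoidAlgebra

/-- The character `n ↦ exp (2 π i n τ)` of `ℤ`. -/
noncomputable def character (τ : ℝ) : Multiplicative ℤ →* ℂ where
  toFun n := Complex.exp (2 * Real.pi * Complex.I * (n.toAdd : ℤ) * τ)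
  map_one' := by simp
  map_mul' m n := by
    rw [← Complex.exp_add]
    congr 1
    push_cast [toAdd_mul]
    ring

/-- The value at `τ` of a trigonometric polynomial. -/
noncomputable def eval (τ : ℝ) : TrigPoly →ₐ[ℂ] ℂ := AddMonoidAlgebra.lift ℂ ℂ ℤ (character τ)

theorem eval_single (τ : ℝ) (n : ℤ) (c : ℂ) :
    eval τ (single n c) = c * Complex.exp (2 * Real.pi * Complex.I * n * τ) := by
  rw [eval, AddMonoidAlgebra.lift_single]
  simp [character]

/-- The primitive with zero mean of a trigonometric polynomial minus its mean. The constant term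
is sent to zero because of `0⁻¹ = 0`. -/
noncomputable def primitive (a : TrigPoly) : TrigPoly :=
  .ofCoeff (Finsupp.onFinset a.coeff.support
    (fun n => (2 * Real.pi * Complex.I * n)⁻¹ * a.coeff n) fun n h => by
      rw [Finsupp.mem_support_iff]
      exact right_ne_zero_of_mul h)

@[simp]
theorem coeff_primitive (a : TrigPoly) (n : ℤ) :
    (primitive a).coeff n = (2 * Real.pi * Complex.I * n)⁻¹ * a.coeff n := rfl

theorem primitive_add (a b : TrigPoly) : primitive (a + b) = primitive a + primitive b := by
  ext n
  simp [mul_add]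

theorem primitive_single (n : ℤ) (c : ℂ) :
    primitive (single n c) = single n ((2 * Real.pi * Complex.I * n)⁻¹ * c) := by
  ext m
  rw [coeff_primitive, AddMonoidAlgebra.coeff_single, AddMonoidAlgebra.coeff_single]
  by_cases h : n = m
  · subst h; simp
  · rw [Finsupp.single_eq_of_ne' h, Finsupp.single_eq_of_ne' h, mul_zero]

theorem hasDerivAt_eval_primitive (a : TrigPoly) (τ : ℝ) :
    HasDerivAt (fun σ => eval σ (primitive a)) (eval τ a - a.coeff 0) τ := by
  induction a using AddMonoidAlgebra.induction_linear with
  | zero =>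
    have h : primitive 0 = 0 := by ext n; simp
    simpa [h] using hasDerivAt_const τ (0 : ℂ)
  | add a b ha hb =>
    rw [primitive_add, map_add, AddMonoidAlgebra.coeff_add, Finsupp.add_apply,
      add_sub_add_comm]
    simp_rw [map_add]
    exact ha.add hb
  | single n c =>
    rw [primitive_single, AddMonoidAlgebra.coeff_single]
    simp_rw [eval_single]
    by_cases hn : n = 0
    · subst hn
      simpa using hasDerivAt_const τ (0 : ℂ)
    · have hn' : (n : ℂ) ≠ 0 := by exact_mod_cast hn
      have h1 : HasDerivAt (fun σ : ℝ => (2 * Real.pi * Complex.I * n * σ : ℂ))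
          (2 * Real.pi * Complex.I * n) τ := by
        simpa using (Complex.ofRealCLM.hasDerivAt (x := τ)).const_mul
          (2 * Real.pi * Complex.I * n : ℂ)
      have hne : (2 * Real.pi * Complex.I * n : ℂ) ≠ 0 := by
        simp [Real.pi_ne_zero, hn']
      refine (h1.cexp.const_mul ((2 * Real.pi * Complex.I * n : ℂ)⁻¹ * c)).congr_deriv ?_
      rw [Finsupp.single_eq_of_ne' hn]
      field_simp
      ring

theorem exists_norm_eval_le (a : TrigPoly) : ∃ C, ∀ τ, ‖eval τ a‖ ≤ C := by
  induction a using AddMonoidAlgebra.induction_linear with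
  | zero => exact ⟨0, by simp⟩
  | add a b ha hb =>
    obtain ⟨A, hA⟩ := ha
    obtain ⟨B, hB⟩ := hb
    refine ⟨A + B, fun τ => ?_⟩
    rw [map_add]
    exact (norm_add_le _ _).trans (add_le_add (hA τ) (hB τ))
  | single n c =>
    refine ⟨‖c‖, fun τ => ?_⟩
    rw [eval_single, norm_mul]
    have : (2 * Real.pi * Complex.I * n * τ : ℂ) = ((2 * Real.pi * n * τ : ℝ) : ℂ) * Complex.I := by
      push_cast; ring
    rw [this, Complex.norm_exp_ofReal_mul_I, mul_one]

/-- The reversal of time `τ ↦ -τ`. -/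
noncomputable def reflect : TrigPoly →+* TrigPoly :=
  AddMonoidAlgebra.mapDomainRingHom ℂ (negAddMonoidHom : ℤ →+ ℤ)

theorem coeff_reflect (a : TrigPoly) (n : ℤ) : (reflect a).coeff n = a.coeff (-n) := by
  have h := Finsupp.mapDomain_apply (f := (Neg.neg : ℤ → ℤ)) neg_injective a.coeff (-n)
  rw [neg_neg] at h
  exact h

theorem reflect_primitive (a : TrigPoly) : reflect (primitive a) = -primitive (reflect a) := by
  ext n
  simp only [coeff_reflect, coeff_primitive, AddMonoidAlgebra.coeff_neg, Finsupp.neg_apply]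
  push_cast
  rw [mul_neg, inv_neg]
  ring

theorem coeff_zero_eq_zero_of_reflect {a : TrigPoly} (h : reflect a = -a) : a.coeff 0 = 0 := by
  have h1 := coeff_reflect a 0
  rw [h] at h1
  simp only [AddMonoidAlgebra.coeff_neg, Finsupp.neg_apply, neg_zero] at h1
  exact self_eq_neg.mp h1.symm

/-- The harmonic of frequency `n`, a multiple of the cosine (for `s = 1`) or of the sine
(for `s = -1`), with coefficient `c` at `n`. -/
noncomputable def harmonic (n : ℤ) (s : ℤ) (c : ℂ) : TrigPoly := single n c + single (-n) (s * c)

theorem coeff_harmonic_mul (n s : ℤ) (c : ℂ) (a : TrigPoly) (m : ℤ) :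
    (harmonic n s c * a).coeff m = c * a.coeff (m - n) + s * c * a.coeff (m + n) := by
  rw [harmonic, add_mul, AddMonoidAlgebra.coeff_add, Finsupp.add_apply]
  congr 1
  · have := AddMonoidAlgebra.coeff_single_mul_eq_mul_coeff (r := c) (x := a) (m := n)
      (m₁ := m) (m - n) (by intros; omega)
    exact this
  · have := AddMonoidAlgebra.coeff_single_mul_eq_mul_coeff (r := s * c) (x := a)
      (m := -n) (m₁ := m) (m + n) (by intros; omega)
    exact this

theorem reflect_harmonic (n : ℤ) {s : ℤ} (hs : s * s = 1) (c : ℂ) :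
    reflect (harmonic n s c) = (s : ℂ) • harmonic n s c := by
  have hs' : (s : ℂ) * (s * c) = c := by
    rw [← mul_assoc, ← Int.cast_mul, hs]; simp
  ext m
  rw [coeff_reflect]
  simp only [harmonic, AddMonoidAlgebra.coeff_add, AddMonoidAlgebra.coeff_smul,
    Finsupp.add_apply, Finsupp.smul_apply, smul_eq_mul, AddMonoidAlgebra.coeff_single,
    Finsupp.single_apply]
  have e1 : (n = -m) ↔ (-n = m) := by omega
  have e2 : (-n = -m) ↔ (n = m) := by omega
  simp only [e1, e2, mul_add, mul_ite, hs', mul_zero]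
  ring

end TrigPoly

/-! ### Iterated integrals of the dithers and their means -/

namespace TrigPoly

open AddMonoidAlgebra

/-- The frequencies of the four dithers. -/
def frequency (κ κ' : ℤ) : Fin 4 → ℤ := ![κ, κ, 3 * κ', κ']

/-- The behaviour of the four dithers under the reversal of time: `1` for a cosine, `-1` for a
sine. -/
def paritySign : Fin 4 → ℤ := ![1, -1, -1, 1]

/-- The Fourier coefficients of the four dithers at their (positive) frequencies. -/
noncomputable def amplitude (κ κ' : ℤ) : Fin 4 → ℂ :=
  ![Real.sqrt (κ * Real.pi), Real.sqrt (κ * Real.pi) / Complex.I,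
    3 * ((2 * κ' * Real.pi) ^ (3 / 4 : ℝ) : ℝ) / Complex.I, ((2 * κ' * Real.pi) ^ (3 / 4 : ℝ) : ℝ)]

/-- The four dithers as trigonometric polynomials. -/
noncomputable def dither (κ κ' : ℤ) (i : Fin 4) : TrigPoly :=
  harmonic (frequency κ κ' i) (paritySign i) (amplitude κ κ' i)

/-- The four dithers as functions. -/
noncomputable def ditherFun (κ κ' : ℤ) (i : Fin 4) (τ : ℝ) : ℝ :=
  ![ditherFst12 κ τ, ditherSnd12 κ τ, ditherFst1222 κ' τ, ditherSnd1222 κ' τ] i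

theorem eval_harmonic_cos (n : ℤ) (c : ℂ) (τ : ℝ) :
    eval τ (harmonic n 1 c) = 2 * c * (Real.cos (2 * n * Real.pi * τ) : ℝ) := by
  rw [harmonic, map_add, eval_single, eval_single, Complex.ofReal_cos, Complex.cos]
  push_cast
  have e1 : (2 * Real.pi * Complex.I * n * τ : ℂ) = 2 * n * Real.pi * τ * Complex.I := by ring
  have e2 : (2 * Real.pi * Complex.I * -n * τ : ℂ) = -(2 * n * Real.pi * τ) * Complex.I := by ring
  rw [e1, e2]
  ring

theorem eval_harmonic_sin (n : ℤ) (c : ℂ) (τ : ℝ) :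
    eval τ (harmonic n (-1) (c / Complex.I)) = 2 * c * (Real.sin (2 * n * Real.pi * τ) : ℝ) := by
  rw [harmonic, map_add, eval_single, eval_single, Complex.ofReal_sin, Complex.sin]
  push_cast
  have e1 : (2 * Real.pi * Complex.I * n * τ : ℂ) = 2 * n * Real.pi * τ * Complex.I := by ring
  have e2 : (2 * Real.pi * Complex.I * -n * τ : ℂ) = -(2 * n * Real.pi * τ) * Complex.I := by ring
  rw [e1, e2, Complex.div_I]
  ring

theorem eval_dither (κ κ' : ℤ) (i : Fin 4) (τ : ℝ) :
    eval τ (dither κ κ' i) = (ditherFun κ κ' i τ : ℂ) := by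
  fin_cases i
  · refine (eval_harmonic_cos κ _ τ).trans ?_
    simp [ditherFun, ditherFst12, amplitude]
  · refine (eval_harmonic_sin κ _ τ).trans ?_
    simp [ditherFun, ditherSnd12]
  · refine (eval_harmonic_sin (3 * κ') _ τ).trans ?_
    have e : (2 * ((3 * κ' : ℤ) : ℝ) * Real.pi * τ) = 6 * κ' * Real.pi * τ := by push_cast; ring
    rw [e]
    simp only [ditherFun, ditherFst1222]
    push_cast
    ring
  · refine (eval_harmonic_cos κ' _ τ).trans ?_
    simp [ditherFun, ditherSnd1222, amplitude]

/-- The oscillating coefficient of the word `w` in the averaging expansion: an iterated zero-mean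
primitive of the dithers. The last letter of `w` is integrated first. -/
noncomputable def wordCoeff (κ κ' : ℤ) : List (Fin 4) → TrigPoly
  | [] => 1
  | i :: w => primitive (dither κ κ' i * wordCoeff κ κ' w)

/-- The mean that is removed before the last integration in `wordCoeff`. -/
noncomputable def wordMean (κ κ' : ℤ) : List (Fin 4) → ℂ
  | [] => 0
  | i :: w => (dither κ κ' i * wordCoeff κ κ' w).coeff 0

theorem reflect_dither (κ κ' : ℤ) (i : Fin 4) :
    reflect (dither κ κ' i) = (paritySign i : ℂ) • dither κ κ' i :=
  reflect_harmonic _ (by fin_cases i <;> rfl) _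

theorem primitive_smul (c : ℂ) (a : TrigPoly) : primitive (c • a) = c • primitive a := by
  ext n
  simp only [coeff_primitive, AddMonoidAlgebra.coeff_smul, Finsupp.smul_apply, smul_eq_mul]
  ring

/-- The sign of `wordCoeff` under the reversal of time. Every integration contributes a sign. -/
def wordSign : List (Fin 4) → ℤ
  | [] => 1
  | i :: w => -(paritySign i * wordSign w)

theorem reflect_wordCoeff (κ κ' : ℤ) (w : List (Fin 4)) :
    reflect (wordCoeff κ κ' w) = (wordSign w : ℂ) • wordCoeff κ κ' w := by
  induction w with
  | nil => simp [wordCoeff, wordSign]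
  | cons i w ih =>
    rw [wordCoeff, reflect_primitive, map_mul, reflect_dither, ih, smul_mul_smul_comm,
      primitive_smul, wordSign]
    push_cast
    rw [neg_smul]

/-- A mean vanishes by parity when the integrand is odd. -/
theorem wordMean_eq_zero_of_wordSign (κ κ' : ℤ) {w : List (Fin 4)} (h : wordSign w = 1) :
    wordMean κ κ' w = 0 := by
  cases w with
  | nil => rfl
  | cons i w =>
    apply coeff_zero_eq_zero_of_reflect
    have h' : paritySign i * wordSign w = -1 := by
      rw [wordSign] at h; omega
    rw [map_mul, reflect_dither, reflect_wordCoeff, smul_mul_smul_comm, ← Int.cast_mul, h']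
    simp

/-- The steps in the frequency lattice made by the four dithers: a pair `(p, q)` stands for the
frequency `p κ + q κ'`. -/
def latticeStep : Fin 4 → ℤ × ℤ := ![(1, 0), (1, 0), (0, 3), (0, 1)]

/-- The lattice points whose frequencies may occur in `wordCoeff`. -/
def spectrum : List (Fin 4) → List (ℤ × ℤ)
  | [] => [(0, 0)]
  | i :: w => (spectrum w).map (· + latticeStep i) ++ (spectrum w).map (· - latticeStep i)

theorem mem_spectrum_of_coeff_mul_ne_zero (κ κ' : ℤ) {i : Fin 4} {w : List (Fin 4)}
    (ih : ∀ n, (wordCoeff κ κ' w).coeff n ≠ 0 → ∃ q ∈ spectrum w, n = q.1 * κ + q.2 * κ')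
    {n : ℤ} (h : (dither κ κ' i * wordCoeff κ κ' w).coeff n ≠ 0) :
    ∃ q ∈ spectrum (i :: w), n = q.1 * κ + q.2 * κ' := by
  have hstep : frequency κ κ' i = (latticeStep i).1 * κ + (latticeStep i).2 * κ' := by
    fin_cases i <;> simp [frequency, latticeStep]
  rw [dither, coeff_harmonic_mul] at h
  by_cases h1 : (wordCoeff κ κ' w).coeff (n - frequency κ κ' i) = 0
  · have h2 : (wordCoeff κ κ' w).coeff (n + frequency κ κ' i) ≠ 0 := by
      intro h2
      rw [h1, h2] at h
      simp at h
    obtain ⟨q, hq, hn⟩ := ih _ h2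
    refine ⟨q - latticeStep i, List.mem_append_right _ (List.mem_map_of_mem hq), ?_⟩
    simp only [Prod.fst_sub, Prod.snd_sub]
    linear_combination hn - hstep
  · obtain ⟨q, hq, hn⟩ := ih _ h1
    refine ⟨q + latticeStep i, List.mem_append_left _ (List.mem_map_of_mem hq), ?_⟩
    simp only [Prod.fst_add, Prod.snd_add]
    linear_combination hn + hstep

theorem mem_spectrum_of_coeff_ne_zero (κ κ' : ℤ) (w : List (Fin 4)) :
    ∀ n, (wordCoeff κ κ' w).coeff n ≠ 0 → ∃ q ∈ spectrum w, n = q.1 * κ + q.2 * κ' := by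
  induction w with
  | nil =>
    intro n hn
    refine ⟨(0, 0), by simp [spectrum], ?_⟩
    by_contra h
    apply hn
    change ((1 : TrigPoly)).coeff n = 0
    rw [AddMonoidAlgebra.one_def, AddMonoidAlgebra.coeff_single, Finsupp.single_eq_of_ne]
    simpa using h
  | cons i w ih =>
    intro n hn
    rw [wordCoeff, coeff_primitive] at hn
    exact mem_spectrum_of_coeff_mul_ne_zero κ κ' ih (right_ne_zero_of_mul hn)

/-- The lattice points, among those reached by short words, whose frequencies cannot vanish under
the non-resonance hypotheses. -/
def Nonresonant (q : ℤ × ℤ) : Prop :=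
  q.1 = 0 ∧ q.2 ≠ 0 ∨ q.1 ≠ 0 ∧ q.2 = 0 ∨ |q.1| = 1 ∧ |q.2| ≤ 6 ∧ |q.2| ≠ 5

instance : DecidablePred Nonresonant := fun q => by unfold Nonresonant; infer_instance

theorem Nonresonant.ne_zero {κ κ' : ℤ} (hκ : 0 < κ) (hκ' : 0 < κ')
    (hres₁ : NoResonance 4 κ κ') (hres₃ : NoResonance 4 κ (3 * κ')) (hres₄ : κ ≠ κ' + 3 * κ')
    {q : ℤ × ℤ} (hq : Nonresonant q) : q.1 * κ + q.2 * κ' ≠ 0 := by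
  obtain ⟨p, q⟩ := q
  have h1 : κ ≠ κ' := fun h => by
    have := (hres₁ 1 (-1) (by norm_num) (by omega)).1; omega
  have h2 : κ ≠ 2 * κ' := fun h => by
    have := (hres₁ 1 (-2) (by norm_num) (by omega)).1; omega
  have h3 : κ ≠ 3 * κ' := fun h => by
    have := (hres₁ 1 (-3) (by norm_num) (by omega)).1; omega
  have h6 : κ ≠ 6 * κ' := fun h => by
    have := (hres₃ 1 (-2) (by norm_num) (by omega)).1; omega
  rcases hq with ⟨hp, hq⟩ | ⟨hp, hq⟩ | ⟨hp, hq, hq5⟩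
  · simp only at hp hq ⊢
    subst hp
    simp [hq, hκ'.ne']
  · simp only at hp hq ⊢
    subst hq
    simp [hp, hκ.ne']
  · simp only at hp hq hq5 ⊢
    obtain ⟨hl, hu⟩ := abs_le.mp hq
    rcases (abs_eq (by norm_num)).mp hp with rfl | rfl <;> interval_cases q <;>
      first | omega | simp at hq5

/-- A mean vanishes by non-resonance when no frequency of the integrand is zero. -/
theorem wordMean_eq_zero_of_spectrum {κ κ' : ℤ} (hκ : 0 < κ) (hκ' : 0 < κ')
    (hres₁ : NoResonance 4 κ κ') (hres₃ : NoResonance 4 κ (3 * κ')) (hres₄ : κ ≠ κ' + 3 * κ')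
    {w : List (Fin 4)} (hw : ∀ q ∈ spectrum w, Nonresonant q) : wordMean κ κ' w = 0 := by
  cases w with
  | nil => rfl
  | cons i w =>
    by_contra h
    obtain ⟨q, hq, hn⟩ :=
      mem_spectrum_of_coeff_mul_ne_zero κ κ' (mem_spectrum_of_coeff_ne_zero κ κ' w) h
    exact (hw q hq).ne_zero hκ hκ' hres₁ hres₃ hres₄ hn.symm

/-- The order of smallness, in powers of `ε ^ (1 / 4)`, of the integral of each input over one
period. -/
def weight : Fin 4 → ℕ := ![2, 2, 1, 1]

/-- The means of the words of weight at most `4`, which are all zero except for those that make up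
the two Lie brackets. -/
def bracketCoeff (w : List (Fin 4)) : ℤ :=
  if w = [0, 1] then -1 else if w = [1, 0] then 1 else if w = [2, 3, 3, 3] then -1 else
  if w = [3, 2, 3, 3] then 3 else if w = [3, 3, 2, 3] then -3 else
  if w = [3, 3, 3, 2] then 1 else 0

/-- Both reasons for a mean to vanish, in decidable form. -/
def HasZeroMean (w : List (Fin 4)) : Prop := wordSign w = 1 ∨ ∀ q ∈ spectrum w, Nonresonant q

instance : DecidablePred HasZeroMean := fun w => by unfold HasZeroMean; infer_instance

section Resonant

variable (κ κ' : ℤ)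

theorem coeff_dither_two_mul (a : TrigPoly) (j : ℤ) :
    (dither κ κ' 2 * a).coeff (j * κ') =
      3 * ((2 * κ' * Real.pi) ^ (3 / 4 : ℝ) : ℝ) / Complex.I *
        (a.coeff ((j - 3) * κ') - a.coeff ((j + 3) * κ')) := by
  have e1 : j * κ' - 3 * κ' = (j - 3) * κ' := by ring
  have e2 : j * κ' + 3 * κ' = (j + 3) * κ' := by ring
  refine (coeff_harmonic_mul (3 * κ') (-1) _ a _).trans ?_
  rw [e1, e2]
  simp only [amplitude, Matrix.cons_val]
  push_cast
  ring

theorem coeff_dither_three_mul (a : TrigPoly) (j : ℤ) :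
    (dither κ κ' 3 * a).coeff (j * κ') =
      ((2 * κ' * Real.pi) ^ (3 / 4 : ℝ) : ℝ) *
        (a.coeff ((j - 1) * κ') + a.coeff ((j + 1) * κ')) := by
  have e1 : j * κ' - κ' = (j - 1) * κ' := by ring
  have e2 : j * κ' + κ' = (j + 1) * κ' := by ring
  refine (coeff_harmonic_mul κ' 1 _ a _).trans ?_
  rw [e1, e2]
  simp only [amplitude, Matrix.cons_val]
  push_cast
  ring

theorem coeff_wordCoeff_two (w : List (Fin 4)) (j : ℤ) :
    (wordCoeff κ κ' (2 :: w)).coeff (j * κ') = (2 * Real.pi * Complex.I * κ')⁻¹ * (j : ℂ)⁻¹ *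
      (3 * ((2 * κ' * Real.pi) ^ (3 / 4 : ℝ) : ℝ) / Complex.I *
        ((wordCoeff κ κ' w).coeff ((j - 3) * κ') - (wordCoeff κ κ' w).coeff ((j + 3) * κ'))) := by
  rw [wordCoeff, coeff_primitive, coeff_dither_two_mul, ← mul_inv]
  push_cast
  congr 2
  ring

theorem coeff_wordCoeff_three (w : List (Fin 4)) (j : ℤ) :
    (wordCoeff κ κ' (3 :: w)).coeff (j * κ') = (2 * Real.pi * Complex.I * κ')⁻¹ * (j : ℂ)⁻¹ *
      (((2 * κ' * Real.pi) ^ (3 / 4 : ℝ) : ℝ) *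
        ((wordCoeff κ κ' w).coeff ((j - 1) * κ') + (wordCoeff κ κ' w).coeff ((j + 1) * κ'))) := by
  rw [wordCoeff, coeff_primitive, coeff_dither_three_mul, ← mul_inv]
  push_cast
  congr 2
  ring

variable {κ'}

theorem coeff_wordCoeff_nil (hκ' : 0 < κ') (j : ℤ) :
    (wordCoeff κ κ' []).coeff (j * κ') = if j = 0 then 1 else 0 := by
  rw [wordCoeff, AddMonoidAlgebra.one_def, AddMonoidAlgebra.coeff_single]
  split_ifs with h
  · simp [h]
  · exact Finsupp.single_eq_of_ne (by simp [h, hκ'.ne'])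

theorem wordMean_two (w : List (Fin 4)) :
    wordMean κ κ' (2 :: w) = 3 * ((2 * κ' * Real.pi) ^ (3 / 4 : ℝ) : ℝ) / Complex.I *
      ((wordCoeff κ κ' w).coeff ((-3) * κ') - (wordCoeff κ κ' w).coeff (3 * κ')) := by
  have := coeff_dither_two_mul κ κ' (wordCoeff κ κ' w) 0
  simpa [wordMean] using this

theorem wordMean_three (w : List (Fin 4)) :
    wordMean κ κ' (3 :: w) = ((2 * κ' * Real.pi) ^ (3 / 4 : ℝ) : ℝ) *
      ((wordCoeff κ κ' w).coeff ((-1) * κ') + (wordCoeff κ κ' w).coeff (1 * κ')) := by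
  have := coeff_dither_three_mul κ κ' (wordCoeff κ κ' w) 0
  simpa [wordMean] using this

/-- Four dither amplitudes cancel the factor `2 π κ'` of three integrations. -/
theorem amplitude_pow_four (hκ' : 0 < κ') :
    (((2 * κ' * Real.pi) ^ (3 / 4 : ℝ) : ℝ) : ℂ) ^ 4 = (2 * κ' * Real.pi) ^ 3 := by
  have h : (0 : ℝ) ≤ 2 * κ' * Real.pi := by
    have : (0 : ℝ) < κ' := by exact_mod_cast hκ'
    positivity
  have h4 : ((2 * κ' * Real.pi : ℝ) ^ (3 / 4 : ℝ)) ^ 4 = (2 * κ' * Real.pi) ^ 3 := by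
    rw [← Real.rpow_natCast, ← Real.rpow_mul h, ← Real.rpow_natCast]
    norm_num
  exact_mod_cast h4

theorem wordMean_resonant (hκ' : 0 < κ') :
    wordMean κ κ' [2, 3, 3, 3] = -1 ∧ wordMean κ κ' [3, 2, 3, 3] = 3 ∧
      wordMean κ κ' [3, 3, 2, 3] = -3 ∧ wordMean κ κ' [3, 3, 3, 2] = 1 := by
  have hk : (κ' : ℂ) ≠ 0 := by exact_mod_cast hκ'.ne'
  have hpi : (Real.pi : ℂ) ≠ 0 := by exact_mod_cast Real.pi_ne_zero
  have h4 := amplitude_pow_four hκ'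
  have hI2 := Complex.I_sq
  have hI4 := Complex.I_pow_four
  simp only [wordMean_two, wordMean_three, coeff_wordCoeff_two, coeff_wordCoeff_three,
    coeff_wordCoeff_nil κ hκ']
  generalize (((2 * κ' * Real.pi) ^ (3 / 4 : ℝ) : ℝ) : ℂ) = B at *
  norm_num
  field_simp
  rw [hI4, h4]
  refine ⟨?_, ?_, ?_, ?_⟩ <;> ring

theorem wordMean_zero_one {κ : ℤ} (hκ : 0 < κ) (κ' : ℤ) :
    wordMean κ κ' [0, 1] = -1 ∧ wordMean κ κ' [1, 0] = 1 := by
  have hk : (κ : ℂ) ≠ 0 := by exact_mod_cast hκ.ne'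
  have hpi : (Real.pi : ℂ) ≠ 0 := by exact_mod_cast Real.pi_ne_zero
  have h2 : ((Real.sqrt (κ * Real.pi) : ℝ) : ℂ) ^ 2 = κ * Real.pi := by
    have h : (0 : ℝ) ≤ κ * Real.pi := by
      have : (0 : ℝ) < κ := by exact_mod_cast hκ
      positivity
    exact_mod_cast Real.sq_sqrt h
  simp only [wordMean, wordCoeff, dither, coeff_harmonic_mul, coeff_primitive, mul_one]
  simp only [frequency, amplitude, paritySign, Matrix.cons_val, harmonic,
    AddMonoidAlgebra.coeff_add, Finsupp.add_apply, AddMonoidAlgebra.coeff_single,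
    Finsupp.single_apply]
  generalize ((Real.sqrt (κ * Real.pi) : ℝ) : ℂ) = B at *
  have e1 : ¬ κ = -κ := by omega
  have e2 : ¬ -κ = κ := by omega
  simp [e1, e2]
  field_simp
  simp only [h2, Complex.I_sq]
  constructor <;> ring

end Resonant

variable {κ κ' : ℤ}

theorem wordMean_eq_bracketCoeff (hκ : 0 < κ) (hκ' : 0 < κ')
    (hres₁ : NoResonance 4 κ κ') (hres₃ : NoResonance 4 κ (3 * κ')) (hres₄ : κ ≠ κ' + 3 * κ')
    (w : List (Fin 4)) (hw : (w.map weight).sum ≤ 4) :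
    wordMean κ κ' w = bracketCoeff w := by
  obtain ⟨r1, r2, r3, r4⟩ := wordMean_resonant κ hκ'
  obtain ⟨r5, r6⟩ := wordMean_zero_one hκ κ'
  by_cases hb : bracketCoeff w = 0
  -- a word of weight at most `4` has at most `4` letters, and the finitely many ones are checked
  · have hz : HasZeroMean w := by
      match w with
      | [] => exact Or.inl rfl
      | [i] => revert i; decide
      | [i, j] => revert i j; decide
      | [i, j, k] => revert i j k; decide
      | [i, j, k, l] => revert i j k l; decide
      | i :: j :: k :: l :: n :: w =>
        have h1 : ∀ i, 1 ≤ weight i := by decide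
        have := h1 i; have := h1 j; have := h1 k; have := h1 l; have := h1 n
        simp only [List.map_cons, List.sum_cons] at hw
        omega
    rw [hb, Int.cast_zero]
    rcases hz with h | h
    · exact wordMean_eq_zero_of_wordSign κ κ' h
    · exact wordMean_eq_zero_of_spectrum hκ hκ' hres₁ hres₃ hres₄ h
  · unfold bracketCoeff at hb ⊢
    split_ifs at hb ⊢ <;> simp_all

end TrigPoly

/-! ### The near-identity expansion -/

/-- The derivative of `h` along the vector field `f`. -/
noncomputable def lieDerivative (f h : ℝ → ℝ) (x : ℝ) : ℝ := f x * deriv h x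

section Expansion

variable {ι : Type*}

/-- The iterated Lie derivative of the identity along the vector fields of a word; the last letter
acts first. -/
noncomputable def wordField (f : ι → ℝ → ℝ) : List ι → ℝ → ℝ
  | [] => id
  | i :: w => lieDerivative (f i) (wordField f w)

/-- The weight of a word. -/
def wordWeight (wt : ι → ℕ) (w : List ι) : ℕ := (w.map wt).sum

theorem wordWeight_cons (wt : ι → ℕ) (i : ι) (w : List ι) :
    wordWeight wt (i :: w) = wt i + wordWeight wt w := by
  simp [wordWeight]

theorem length_le_wordWeight {wt : ι → ℕ} (hwt : ∀ i, 1 ≤ wt i) (w : List ι) :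
    w.length ≤ wordWeight wt w := by
  induction w with
  | nil => simp
  | cons i w ih =>
    have := hwt i
    rw [wordWeight_cons, List.length_cons]
    omega

theorem contDiffOn_wordField {f : ι → ℝ → ℝ} {D : Set ℝ} (hD : IsOpen D)
    (hf : ∀ i, ContDiffOn ℝ 4 (f i) D) (w : List ι) :
    ∀ n : ℕ, n + w.length ≤ 5 → ContDiffOn ℝ n (wordField f w) D := by
  induction w with
  | nil => exact fun n _ => contDiffOn_id
  | cons i w ih =>
    intro n hn
    rw [List.length_cons] at hn
    have h1 : ContDiffOn ℝ n (deriv (wordField f w)) D :=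
      (ih (n + 1) (by omega)).deriv_of_isOpen hD (by push_cast; rfl)
    have h2 : ContDiffOn ℝ n (f i) D := (hf i).of_le (by exact_mod_cast (by omega : n ≤ 4))
    exact h2.mul h1

/-- `B η x τ = O(η ^ k)`, uniformly in `η ∈ (0, 1]`, `x ∈ K` and `τ ∈ ℝ`. -/
def IsUniformlyBigO (K : Set ℝ) (k : ℕ) (B : ℝ → ℝ → ℝ → ℝ) : Prop :=
  ∃ C, ∀ η ∈ Set.Ioc (0 : ℝ) 1, ∀ x ∈ K, ∀ τ, |B η x τ| ≤ C * η ^ k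

namespace IsUniformlyBigO

variable {K : Set ℝ} {k l : ℕ} {B B' : ℝ → ℝ → ℝ → ℝ}

theorem zero : IsUniformlyBigO K k fun _ _ _ => 0 := ⟨0, by simp⟩

theorem neg (h : IsUniformlyBigO K k B) : IsUniformlyBigO K k fun η x τ => -B η x τ := by
  simpa [IsUniformlyBigO] using h

theorem add (h : IsUniformlyBigO K k B) (h' : IsUniformlyBigO K k B') :
    IsUniformlyBigO K k fun η x τ => B η x τ + B' η x τ := by
  obtain ⟨C, hC⟩ := h
  obtain ⟨C', hC'⟩ := h'
  refine ⟨C + C', fun η hη x hx τ => (abs_add_le _ _).trans ?_⟩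
  rw [add_mul]
  exact add_le_add (hC η hη x hx τ) (hC' η hη x hx τ)

theorem sum {κ : Type*} (s : Finset κ) {B : κ → ℝ → ℝ → ℝ → ℝ}
    (h : ∀ i ∈ s, IsUniformlyBigO K k (B i)) :
    IsUniformlyBigO K k fun η x τ => ∑ i ∈ s, B i η x τ := by
  classical
  induction s using Finset.induction_on with
  | empty => simpa using zero
  | insert a s ha ih =>
    simp only [Finset.sum_insert ha]
    exact (h a (by simp)).add (ih fun i hi => h i (by simp [hi]))

theorem mul (h : IsUniformlyBigO K k B) (h' : IsUniformlyBigO K l B') :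
    IsUniformlyBigO K (k + l) fun η x τ => B η x τ * B' η x τ := by
  obtain ⟨C, hC⟩ := h
  obtain ⟨C', hC'⟩ := h'
  refine ⟨C * C', fun η hη x hx τ => ?_⟩
  rw [abs_mul]
  calc |B η x τ| * |B' η x τ| ≤ (C * η ^ k) * (C' * η ^ l) :=
        mul_le_mul (hC η hη x hx τ) (hC' η hη x hx τ) (abs_nonneg _)
          ((abs_nonneg _).trans (hC η hη x hx τ))
    _ = C * C' * η ^ (k + l) := by rw [pow_add]; ring

theorem pow (k : ℕ) : IsUniformlyBigO K k fun η _ _ => η ^ k :=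
  ⟨1, fun η hη x hx τ => by rw [one_mul, abs_of_nonneg (pow_nonneg hη.1.le k)]⟩

theorem mono (h : IsUniformlyBigO K k B) (hl : l ≤ k) : IsUniformlyBigO K l B := by
  obtain ⟨C, hC⟩ := h
  refine ⟨|C|, fun η hη x hx τ => (hC η hη x hx τ).trans ?_⟩
  exact mul_le_mul (le_abs_self C) (pow_le_pow_of_le_one hη.1.le hη.2 hl)
    (pow_nonneg hη.1.le k) (abs_nonneg C)

theorem of_continuousOn (hK : IsCompact K) {g : ℝ → ℝ} (hg : ContinuousOn g K) :
    IsUniformlyBigO K 0 fun _ x _ => g x := by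
  obtain ⟨C, hC⟩ := hK.exists_bound_of_continuousOn hg
  exact ⟨C, fun η _ x hx _ => by simpa using hC x hx⟩

theorem of_bounded {g : ℝ → ℝ} (hg : ∃ C, ∀ τ, |g τ| ≤ C) :
    IsUniformlyBigO K 0 fun _ _ τ => g τ := by
  obtain ⟨C, hC⟩ := hg
  exact ⟨C, fun η _ x _ τ => by simpa using hC τ⟩

end IsUniformlyBigO

theorem isUniformlyBigO_wordField {f : ι → ℝ → ℝ} {D K : Set ℝ} (hD : IsOpen D)
    (hK : IsCompact K) (hKD : K ⊆ D)
    (hf : ∀ i, ContDiffOn ℝ 4 (f i) D) {w : List ι} (hw : w.length ≤ 5) :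
    IsUniformlyBigO K 0 fun _ x _ => wordField f w x :=
  .of_continuousOn hK ((contDiffOn_wordField hD hf w 0 (by omega)).continuousOn.mono hKD)

variable [Fintype ι] (wt : ι → ℕ) (f v : ι → ℝ → ℝ) (p : List ι → ℝ → ℝ) (μ : List ι → ℝ) (η : ℝ)

/-- The near-identity expansion, over the words of weight at most `4` that extend `w` by at most
`n` letters. At the empty word and with `n = 4` it is the change of variables that averages the
system `dx/dτ = ∑ η ^ wt i * v i τ * f i x`. -/
noncomputable def expansion : ℕ → List ι → ℝ → ℝ → ℝ
  | 0, w, x, τ => p w τ * wordField f w x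
  | n + 1, w, x, τ => p w τ * wordField f w x -
      ∑ i, if wordWeight wt (i :: w) ≤ 4 then η ^ wt i * expansion n (i :: w) x τ else 0

/-- The contribution of the means to the derivative of `expansion` along a solution. -/
noncomputable def resonantPart : ℕ → List ι → ℝ → ℝ
  | 0, _, _ => 0
  | n + 1, w, x => ∑ i, if wordWeight wt (i :: w) ≤ 4 then
      η ^ wt i * (μ (i :: w) * wordField f (i :: w) x - resonantPart n (i :: w) x) else 0

/-- The contribution of the words of weight more than `4` to the derivative of `expansion` along a
solution. -/
noncomputable def remainder : ℕ → List ι → ℝ → ℝ → ℝ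
  | 0, w, x, τ => ∑ i, η ^ wt i * (v i τ * p w τ * wordField f (i :: w) x)
  | n + 1, w, x, τ => ∑ i, if wordWeight wt (i :: w) ≤ 4 then
      -(η ^ wt i * remainder n (i :: w) x τ)
      else η ^ wt i * (v i τ * p w τ * wordField f (i :: w) x)

variable {wt f v p μ}

/-- The derivative of the expansion along a solution: the oscillating terms of each word are
cancelled by the primitives attached to its one-letter extensions, so that only the means and the
words of weight more than `4` survive. Here `c` is the speed of the fast time. -/
theorem hasDerivWithinAt_expansion {D : Set ℝ} (hD : IsOpen D)
    (hf : ∀ i, ContDiffOn ℝ 4 (f i) D)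
    (hp : ∀ i w τ, HasDerivAt (p (i :: w)) (v i τ * p w τ - μ (i :: w)) τ)
    {c : ℝ} {x : ℝ → ℝ} {I : Set ℝ} {t : ℝ} (hxt : x t ∈ D)
    (hx : HasDerivWithinAt x (c * ∑ i, η ^ wt i * (v i (c * t) * f i (x t))) I t) (n : ℕ) :
    ∀ (w : List ι) (d : ℝ), n + w.length ≤ 4 → HasDerivAt (p w) d (c * t) →
      HasDerivWithinAt (fun s => expansion wt f p η n w (x s) (c * s))
        (c * (d * wordField f w (x t) + resonantPart wt f μ η n w (x t) +
          remainder wt f v p η n w (x t) (c * t))) I t := by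
  have main : ∀ (w : List ι) (d : ℝ), w.length ≤ 4 → HasDerivAt (p w) d (c * t) →
      HasDerivWithinAt (fun s => p w (c * s) * wordField f w (x s))
        (c * (d * wordField f w (x t) +
          ∑ i, η ^ wt i * (v i (c * t) * p w (c * t) * wordField f (i :: w) (x t)))) I t := by
    intro w d hw hd
    have h1 : HasDerivWithinAt (fun s => p w (c * s)) (d * c) I t := by
      have hc : HasDerivAt (fun s : ℝ => c * s) c t := by
        simpa using (hasDerivAt_id t).const_mul c
      exact (hd.comp t hc).hasDerivWithinAt
    have hdiff : DifferentiableAt ℝ (wordField f w) (x t) :=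
      ((contDiffOn_wordField hD hf w 1 (by omega)).differentiableOn (by norm_num)).differentiableAt
        (hD.mem_nhds hxt)
    have h2 : HasDerivWithinAt (fun s => wordField f w (x s)) _ I t :=
      hdiff.hasDerivAt.comp_hasDerivWithinAt t hx
    refine (h1.mul h2).congr_deriv ?_
    rw [mul_add, Finset.mul_sum, Finset.mul_sum, Finset.mul_sum, Finset.mul_sum]
    congr 1
    · ring
    · refine Finset.sum_congr rfl fun i _ => ?_
      simp only [wordField, lieDerivative]
      ring
  induction n with
  | zero =>
    intro w d hw hd
    refine (main w d (by omega) hd).congr_deriv ?_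
    simp [resonantPart, remainder]
  | succ n ih =>
    intro w d hw hd
    have hsum : HasDerivWithinAt (fun s => ∑ i, if wordWeight wt (i :: w) ≤ 4 then
          η ^ wt i * expansion wt f p η n (i :: w) (x s) (c * s) else 0)
        (∑ i, if wordWeight wt (i :: w) ≤ 4 then η ^ wt i *
          (c * ((v i (c * t) * p w (c * t) - μ (i :: w)) * wordField f (i :: w) (x t) +
            resonantPart wt f μ η n (i :: w) (x t) +
            remainder wt f v p η n (i :: w) (x t) (c * t))) else 0) I t := by
      refine HasDerivWithinAt.fun_sum fun i _ => ?_
      split_ifs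
      · exact (ih (i :: w) _ (by rw [List.length_cons]; omega) (hp i w _)).const_mul _
      · exact hasDerivWithinAt_const _ _ _
    refine ((main w d (by omega) hd).sub hsum).congr_deriv ?_
    simp only [resonantPart, remainder]
    rw [add_assoc, ← Finset.sum_add_distrib, mul_add, mul_add, Finset.mul_sum, Finset.mul_sum,
      add_sub_assoc, ← Finset.sum_sub_distrib]
    congr 1
    refine Finset.sum_congr rfl fun i _ => ?_
    split_ifs <;> ring

theorem isUniformlyBigO_remainder {D K : Set ℝ} (hD : IsOpen D) (hK : IsCompact K) (hKD : K ⊆ D)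
    (hf : ∀ i, ContDiffOn ℝ 4 (f i) D) (hwt : ∀ i, 1 ≤ wt i)
    (hpb : ∀ w, ∃ C, ∀ τ, |p w τ| ≤ C) (hvb : ∀ i, ∃ C, ∀ τ, |v i τ| ≤ C) (n : ℕ) :
    ∀ w : List ι, n + w.length = 4 →
      IsUniformlyBigO K (5 - wordWeight wt w) fun η => remainder wt f v p η n w := by
  have main : ∀ (w : List ι) i, w.length ≤ 4 → IsUniformlyBigO K (wt i)
      fun η x τ => η ^ wt i * (v i τ * p w τ * wordField f (i :: w) x) := by
    intro w i hw
    have h := (IsUniformlyBigO.pow (K := K) (wt i)).mul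
      (((IsUniformlyBigO.of_bounded (hvb i)).mul (IsUniformlyBigO.of_bounded (hpb w))).mul
        (isUniformlyBigO_wordField hD hK hKD hf (w := i :: w)
          (by rw [List.length_cons]; omega)))
    simpa using h
  induction n with
  | zero =>
    intro w hw
    refine IsUniformlyBigO.sum _ fun i _ => (main w i (by omega)).mono ?_
    have := hwt i
    have := length_le_wordWeight hwt w
    omega
  | succ n ih =>
    intro w hw
    refine IsUniformlyBigO.sum _ fun i _ => ?_
    have hcons := wordWeight_cons wt i w
    split_ifs with h
    · exact (((IsUniformlyBigO.pow (wt i)).mul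
        (ih (i :: w) (by rw [List.length_cons]; omega))).mono (by omega)).neg
    · exact (main w i (by omega)).mono (by omega)

theorem isUniformlyBigO_expansion {D K : Set ℝ} (hD : IsOpen D) (hK : IsCompact K) (hKD : K ⊆ D)
    (hf : ∀ i, ContDiffOn ℝ 4 (f i) D)
    (hpb : ∀ w, ∃ C, ∀ τ, |p w τ| ≤ C) (n : ℕ) :
    ∀ w : List ι, n + w.length ≤ 4 →
      IsUniformlyBigO K 0 fun η => expansion wt f p η n w := by
  have main : ∀ w : List ι, w.length ≤ 4 →
      IsUniformlyBigO K 0 fun _ x τ => p w τ * wordField f w x := fun w hw =>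
    (IsUniformlyBigO.of_bounded (hpb w)).mul
      (isUniformlyBigO_wordField hD hK hKD hf (w := w) (by omega))
  induction n with
  | zero => exact fun w hw => main w (by omega)
  | succ n ih =>
    intro w hw
    simp only [expansion, sub_eq_add_neg]
    refine (main w (by omega)).add (IsUniformlyBigO.sum _ fun i _ => ?_).neg
    split_ifs with h
    · exact ((IsUniformlyBigO.pow (wt i)).mul
        (ih (i :: w) (by rw [List.length_cons]; omega))).mono (by omega)
    · exact .zero

theorem isUniformlyBigO_expansion_sub {D K : Set ℝ} (hD : IsOpen D) (hK : IsCompact K)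
    (hKD : K ⊆ D) (hf : ∀ i, ContDiffOn ℝ 4 (f i) D) (hwt : ∀ i, 1 ≤ wt i)
    (hpb : ∀ w, ∃ C, ∀ τ, |p w τ| ≤ C) (hp0 : ∀ τ, p [] τ = 1) :
    IsUniformlyBigO K 1 fun η x τ => expansion wt f p η 4 [] x τ - x := by
  simp only [expansion, hp0, wordField, id, one_mul, sub_sub_cancel_left]
  refine (IsUniformlyBigO.sum _ fun i _ => ?_).neg
  split_ifs with h
  · refine ((IsUniformlyBigO.pow (wt i)).mul
      (isUniformlyBigO_expansion (wt := wt) hD hK hKD hf hpb 3 [i] (by simp))).mono ?_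
    exact (hwt i).trans (by omega)
  · exact .zero

end Expansion

/-! ### Lie brackets and the averaged field -/

/-- The means of words of weight more than `4` do not enter the resonant part. -/
theorem resonantPart_congr {ι : Type*} [Fintype ι] {wt : ι → ℕ} {f : ι → ℝ → ℝ}
    {μ μ' : List ι → ℝ} (h : ∀ w, wordWeight wt w ≤ 4 → μ w = μ' w) (η : ℝ) (n : ℕ) :
    ∀ w, resonantPart wt f μ η n w = resonantPart wt f μ' η n w := by
  induction n with
  | zero => exact fun w => rfl
  | succ n ih =>
    intro w
    funext x
    refine Finset.sum_congr rfl fun i _ => ?_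
    split_ifs with hi
    · rw [h _ hi, ih]
    · rfl

theorem resonantPart_bracketCoeff (f : Fin 4 → ℝ → ℝ) (η x : ℝ) :
    resonantPart TrigPoly.weight f (fun w => (TrigPoly.bracketCoeff w : ℝ)) η 4 [] x =
      η ^ 4 * (wordField f [0, 1] x - wordField f [1, 0] x + (wordField f [2, 3, 3, 3] x -
        3 * wordField f [3, 2, 3, 3] x + 3 * wordField f [3, 3, 2, 3] x -
        wordField f [3, 3, 3, 2] x)) := by
  simp [resonantPart, Fin.sum_univ_four, wordWeight, TrigPoly.weight, TrigPoly.bracketCoeff]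
  ring

theorem lieBracket_eq_lieDerivative (f h : ℝ → ℝ) :
    VectorField.lieBracket ℝ f h = fun x => lieDerivative f h x - lieDerivative h f x := by
  funext x
  simp [VectorField.lieBracket, lieDerivative, fderiv_eq_smul_deriv]

theorem lieDerivative_congr {D : Set ℝ} (hD : IsOpen D) {f h h' : ℝ → ℝ} (hh : Set.EqOn h h' D) :
    Set.EqOn (lieDerivative f h) (lieDerivative f h') D := fun x hx => by
  rw [lieDerivative, lieDerivative,
    (Filter.eventuallyEq_of_mem (hD.mem_nhds hx) hh).deriv_eq]

/-- The Lie derivative along a Lie bracket is the commutator of the Lie derivatives. -/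
theorem lieDerivative_lieBracket {D : Set ℝ} (hD : IsOpen D) {f h k : ℝ → ℝ}
    (hf : DifferentiableOn ℝ f D) (hh : DifferentiableOn ℝ h D)
    (hk : DifferentiableOn ℝ (deriv k) D) :
    Set.EqOn (lieDerivative (VectorField.lieBracket ℝ f h) k)
      (fun x => lieDerivative f (lieDerivative h k) x - lieDerivative h (lieDerivative f k) x)
      D := fun x hx => by
  have hn := hD.mem_nhds hx
  have e : ∀ {a : ℝ → ℝ}, DifferentiableOn ℝ a D → deriv (lieDerivative a k) x =
      deriv a x * deriv k x + a x * deriv (deriv k) x := fun {a} ha =>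
    ((ha.differentiableAt hn).hasDerivAt.mul (hk.differentiableAt hn).hasDerivAt).deriv
  simp only [lieBracket_eq_lieDerivative]
  rw [lieDerivative, lieDerivative, lieDerivative, lieDerivative, lieDerivative, e hf, e hh]
  ring

theorem lieDerivative_sub {D : Set ℝ} (hD : IsOpen D) (f : ℝ → ℝ) {h k : ℝ → ℝ}
    (hh : DifferentiableOn ℝ h D) (hk : DifferentiableOn ℝ k D) :
    Set.EqOn (lieDerivative f fun x => h x - k x)
      (fun x => lieDerivative f h x - lieDerivative f k x) D := fun x hx => by
  have hn := hD.mem_nhds hx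
  simp only [lieDerivative]
  rw [deriv_fun_sub (hh.differentiableAt hn) (hk.differentiableAt hn), mul_sub]

theorem wordField_singleton {ι : Type*} (f : ι → ℝ → ℝ) (i : ι) : wordField f [i] = f i := by
  funext x
  simp [wordField, lieDerivative]

theorem wordField_cons_cons {ι : Type*} (f : ι → ℝ → ℝ) (i j : ι) (w : List ι) :
    wordField f (i :: j :: w) = lieDerivative (f i) (wordField f (j :: w)) := rfl

/-- The averaged vector field of the four-input system. -/
noncomputable def averagedField (f : Fin 4 → ℝ → ℝ) (x : ℝ) : ℝ :=
  VectorField.lieBracket ℝ (f 0) (f 1) x +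
    VectorField.lieBracket ℝ
      (VectorField.lieBracket ℝ (VectorField.lieBracket ℝ (f 2) (f 3)) (f 3)) (f 3) x

section Averaged

variable {D : Set ℝ} {f : Fin 4 → ℝ → ℝ}

/-- The brackets expanded into words. The coefficients are those of `TrigPoly.bracketCoeff`, up to
the sign `(-1) ^ (length - 1)` with which a word enters the expansion. -/
theorem averagedField_eq_wordField (hD : IsOpen D) (hf : ∀ i, ContDiffOn ℝ 4 (f i) D) :
    Set.EqOn (averagedField f) (fun x => wordField f [0, 1] x - wordField f [1, 0] x +
      (wordField f [2, 3, 3, 3] x - 3 * wordField f [3, 2, 3, 3] x +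
        3 * wordField f [3, 3, 2, 3] x - wordField f [3, 3, 3, 2] x)) D := by
  have hdiff : ∀ w : List (Fin 4), w.length ≤ 4 → DifferentiableOn ℝ (wordField f w) D :=
    fun w hw => (contDiffOn_wordField hD hf w 1 (by omega)).differentiableOn (by norm_num)
  have hdiff' : ∀ w : List (Fin 4), w.length ≤ 3 → DifferentiableOn ℝ (deriv (wordField f w)) D :=
    fun w hw => ((contDiffOn_wordField hD hf w 2 (by omega)).deriv_of_isOpen (m := 1) hD
      (by norm_num)).differentiableOn (by norm_num)
  have e2 : f 2 = wordField f [2] := (wordField_singleton f 2).symm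
  have e3 : f 3 = wordField f [3] := (wordField_singleton f 3).symm
  have h2 : DifferentiableOn ℝ (f 2) D := e2 ▸ hdiff [2] (by simp)
  have h3 : DifferentiableOn ℝ (f 3) D := e3 ▸ hdiff [3] (by simp)
  set A := VectorField.lieBracket ℝ (f 2) (f 3) with hA
  set B := VectorField.lieBracket ℝ A (f 3) with hB
  have A_eq : A = fun x => wordField f [2, 3] x - wordField f [3, 2] x := by
    simp only [hA, lieBracket_eq_lieDerivative, wordField_cons_cons, wordField_singleton]
  have hAd : DifferentiableOn ℝ A D := by
    rw [A_eq]
    exact (hdiff [2, 3] (by simp)).sub (hdiff [3, 2] (by simp))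
  have A3 : Set.EqOn (lieDerivative A (f 3))
      (fun x => wordField f [2, 3, 3] x - wordField f [3, 2, 3] x) D := by
    have := lieDerivative_lieBracket hD h2 h3 (hdiff' [3] (by simp))
    simpa only [wordField_cons_cons, wordField_singleton] using this
  have A33 : Set.EqOn (lieDerivative A (lieDerivative (f 3) (f 3)))
      (fun x => wordField f [2, 3, 3, 3] x - wordField f [3, 2, 3, 3] x) D := by
    have := lieDerivative_lieBracket hD h2 h3 (hdiff' [3, 3] (by simp))
    simpa only [wordField_cons_cons, wordField_singleton] using this
  have D3A : Set.EqOn (lieDerivative (f 3) A)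
      (fun x => wordField f [3, 2, 3] x - wordField f [3, 3, 2] x) D := by
    rw [A_eq]
    exact lieDerivative_sub hD _ (hdiff [2, 3] (by simp)) (hdiff [3, 2] (by simp))
  have B_eq : Set.EqOn B (fun x => (wordField f [2, 3, 3] x - wordField f [3, 2, 3] x) -
      (wordField f [3, 2, 3] x - wordField f [3, 3, 2] x)) D := fun x hx => by
    rw [hB, lieBracket_eq_lieDerivative]
    exact congrArg₂ _ (A3 hx) (D3A hx)
  have d1 : DifferentiableOn ℝ (fun x => wordField f [2, 3, 3] x - wordField f [3, 2, 3] x) D :=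
    (hdiff [2, 3, 3] (by simp)).sub (hdiff [3, 2, 3] (by simp))
  have d2 : DifferentiableOn ℝ (fun x => wordField f [3, 2, 3] x - wordField f [3, 3, 2] x) D :=
    (hdiff [3, 2, 3] (by simp)).sub (hdiff [3, 3, 2] (by simp))
  intro x hx
  have s1 := lieDerivative_sub hD (f 3) (hdiff [2, 3, 3] (by simp)) (hdiff [3, 2, 3] (by simp)) hx
  have s2 := lieDerivative_sub hD (f 3) (hdiff [3, 2, 3] (by simp)) (hdiff [3, 3, 2] (by simp)) hx
  have D3B := (lieDerivative_congr (f := f 3) hD B_eq hx).trans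
    (lieDerivative_sub hD (f 3) d1 d2 hx)
  have D3A3 := lieDerivative_congr (f := f 3) hD A3 hx
  have B3 := lieDerivative_lieBracket hD hAd h3
    (by rw [e3]; exact hdiff' [3] (by simp) : DifferentiableOn ℝ (deriv (f 3)) D) hx
  have hA33 := A33 hx
  have e01 : VectorField.lieBracket ℝ (f 0) (f 1) x =
      wordField f [0, 1] x - wordField f [1, 0] x := by
    simp only [lieBracket_eq_lieDerivative, wordField_cons_cons, wordField_singleton]
  have eB : VectorField.lieBracket ℝ B (f 3) x =
      lieDerivative B (f 3) x - lieDerivative (f 3) B x := by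
    rw [lieBracket_eq_lieDerivative]
  simp only [averagedField, ← hA, ← hB]
  rw [e01, eB]
  simp only [wordField_cons_cons, wordField_singleton] at D3B s1 s2 B3 hA33 D3A3 ⊢
  rw [D3B, s1, s2, B3, hA33, D3A3, s1]
  ring

theorem continuousOn_averagedField (hD : IsOpen D) (hf : ∀ i, ContDiffOn ℝ 4 (f i) D) :
    ContinuousOn (averagedField f) D := by
  have h : ∀ w : List (Fin 4), w.length ≤ 5 → ContinuousOn (wordField f w) D :=
    fun w hw => (contDiffOn_wordField hD hf w 0 (by omega)).continuousOn
  refine ContinuousOn.congr ?_ (averagedField_eq_wordField hD hf)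
  have h1 := h [0, 1] (by simp)
  have h2 := h [1, 0] (by simp)
  have h3 := h [2, 3, 3, 3] (by simp)
  have h4 := h [3, 2, 3, 3] (by simp)
  have h5 := h [3, 3, 2, 3] (by simp)
  have h6 := h [3, 3, 3, 2] (by simp)
  fun_prop

end Averaged

/-- The family `ẋ = G ε t x` is averaged by the vector field `F` on `D`: along its solutions in a
compact set, some function at distance `O(ε ^ (1 / 4))` satisfies `ż = F(x) + O(ε ^ (1 / 4))`. -/
def IsAveragedBy (G : ℝ → ℝ → ℝ → ℝ) (D : Set ℝ) (F : ℝ → ℝ) : Prop :=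
  ∀ K ⊆ D, IsCompact K → ∃ C, ∀ ε ∈ Set.Ioc (0 : ℝ) 1, ∀ (I : Set ℝ) (x : ℝ → ℝ),
    (∀ t ∈ I, x t ∈ K) → IsSolutionOn (G ε) D I x → ∃ z z' : ℝ → ℝ, ∀ t ∈ I,
      HasDerivWithinAt z (z' t) I t ∧ |z t - x t| ≤ C * ε ^ (1 / 4 : ℝ) ∧
        |z' t - F (x t)| ≤ C * ε ^ (1 / 4 : ℝ)

theorem esField_eq_sum (g : Fin 4 → ℝ → ℝ) (J : ℝ → ℝ) (κ κ' : ℤ) {ε : ℝ} (hε : 0 < ε) (t x : ℝ) :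
    esField g J κ κ' ε t x = ε⁻¹ * ∑ i, (ε ^ (1 / 4 : ℝ)) ^ TrigPoly.weight i *
      (TrigPoly.ditherFun κ κ' i (ε⁻¹ * t) * (g i ∘ J) x) := by
  have e1 : ε ^ (-(1 / 2) : ℝ) = ε⁻¹ * (ε ^ (1 / 4 : ℝ)) ^ 2 := by
    rw [← Real.rpow_neg_one, ← Real.rpow_natCast, ← Real.rpow_mul hε.le, ← Real.rpow_add hε]
    norm_num
  have e2 : ε ^ (-(3 / 4) : ℝ) = ε⁻¹ * (ε ^ (1 / 4 : ℝ)) := by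
    rw [← Real.rpow_neg_one, ← Real.rpow_add hε]
    norm_num
  have e3 : t / ε = ε⁻¹ * t := by rw [div_eq_inv_mul]
  simp only [esField, input, TrigPoly.ditherFun, TrigPoly.weight, Fin.sum_univ_four,
    Matrix.cons_val, e1, e2, e3, Function.comp]
  ring

/-- The extremum seeking system is averaged by the sum of its two Lie brackets. -/
theorem isAveragedBy_esField {D : Set ℝ} (hD : IsOpen D) {g : Fin 4 → ℝ → ℝ} {J : ℝ → ℝ}
    (hg : ∀ k, ContDiffOn ℝ 4 (g k ∘ J) D) {κ κ' : ℤ} (hκ : 0 < κ) (hκ' : 0 < κ')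
    (hres₁ : NoResonance 4 κ κ') (hres₃ : NoResonance 4 κ (3 * κ')) (hres₄ : κ ≠ κ' + 3 * κ') :
    IsAveragedBy (esField g J κ κ') D (averagedField fun k => g k ∘ J) := by
  intro K hKD hK
  set f : Fin 4 → ℝ → ℝ := fun k => g k ∘ J with hfdef
  set p : List (Fin 4) → ℝ → ℝ := fun w τ => (TrigPoly.eval τ (TrigPoly.wordCoeff κ κ' w)).re
  set μ : List (Fin 4) → ℝ := fun w => (TrigPoly.wordMean κ κ' w).re with hμdef
  have hμ : ∀ w, wordWeight TrigPoly.weight w ≤ 4 → μ w = TrigPoly.bracketCoeff w := fun w hw => by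
    rw [hμdef]
    simp only
    rw [TrigPoly.wordMean_eq_bracketCoeff hκ hκ' hres₁ hres₃ hres₄ w hw, Complex.intCast_re]
  have hp : ∀ i w τ, HasDerivAt (p (i :: w))
      (TrigPoly.ditherFun κ κ' i τ * p w τ - μ (i :: w)) τ := fun i w τ => by
    have h := TrigPoly.hasDerivAt_eval_primitive
      (TrigPoly.dither κ κ' i * TrigPoly.wordCoeff κ κ' w) τ
    have h' := (Complex.reCLM.hasFDerivAt.comp_hasDerivAt τ h)
    refine h'.congr_deriv ?_
    rw [map_mul, TrigPoly.eval_dither]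
    simp [p, μ, TrigPoly.wordMean]
  have hp0 : ∀ τ, p [] τ = 1 := fun τ => by simp [p, TrigPoly.wordCoeff]
  have hpb : ∀ w, ∃ C, ∀ τ, |p w τ| ≤ C := fun w => by
    obtain ⟨C, hC⟩ := TrigPoly.exists_norm_eval_le (TrigPoly.wordCoeff κ κ' w)
    exact ⟨C, fun τ => (Complex.abs_re_le_norm _).trans (hC τ)⟩
  have hvb : ∀ i, ∃ C, ∀ τ, |TrigPoly.ditherFun κ κ' i τ| ≤ C := fun i => by
    obtain ⟨C, hC⟩ := TrigPoly.exists_norm_eval_le (TrigPoly.dither κ κ' i)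
    refine ⟨C, fun τ => ?_⟩
    have := hC τ
    rwa [TrigPoly.eval_dither, Complex.norm_real, Real.norm_eq_abs] at this
  have hwt : ∀ i, 1 ≤ TrigPoly.weight i := by decide
  obtain ⟨C₁, hC₁⟩ := isUniformlyBigO_expansion_sub (wt := TrigPoly.weight) hD hK hKD hg hwt hpb hp0
  obtain ⟨C₂, hC₂⟩ := isUniformlyBigO_remainder hD hK hKD hg hwt hpb hvb 4 [] rfl
  refine ⟨max C₁ C₂, fun ε hε I x hxK hx => ?_⟩
  set η := ε ^ (1 / 4 : ℝ) with hη
  have hη0 : 0 < η := Real.rpow_pos_of_pos hε.1 _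
  have hη1 : η ≤ 1 := Real.rpow_le_one hε.1.le hε.2 (by norm_num)
  have hη4 : η ^ 4 = ε := by
    rw [hη, ← Real.rpow_natCast, ← Real.rpow_mul hε.1.le]
    norm_num
  refine ⟨fun s => expansion TrigPoly.weight f p η 4 [] (x s) (ε⁻¹ * s), fun t =>
    averagedField f (x t) + ε⁻¹ * remainder TrigPoly.weight f (TrigPoly.ditherFun κ κ') p η 4 []
      (x t) (ε⁻¹ * t), fun t ht => ⟨?_, ?_, ?_⟩⟩
  · have hxD : x t ∈ D := hKD (hxK t ht)
    have hd := (hx t ht).2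
    rw [esField_eq_sum g J κ κ' hε.1] at hd
    refine (hasDerivWithinAt_expansion η hD hg hp hxD hd 4 [] 0 (by simp) ?_).congr_deriv ?_
    · have : p [] = fun _ => 1 := funext hp0
      rw [this]
      exact hasDerivAt_const _ _
    · rw [resonantPart_congr hμ, resonantPart_bracketCoeff, hη4, zero_mul, zero_add, mul_add,
        inv_mul_cancel_left₀ hε.1.ne']
      exact congrArg (· + _) (averagedField_eq_wordField hD hg hxD).symm
  · refine (hC₁ η ⟨hη0, hη1⟩ _ (hxK t ht) _).trans ?_
    rw [pow_one]
    exact mul_le_mul_of_nonneg_right (le_max_left _ _) hη0.le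
  · rw [add_sub_cancel_left, abs_mul, abs_of_pos (inv_pos.2 hε.1)]
    calc ε⁻¹ * _ ≤ ε⁻¹ * (C₂ * η ^ 5) :=
          mul_le_mul_of_nonneg_left (hC₂ η ⟨hη0, hη1⟩ _ (hxK t ht) _) (inv_pos.2 hε.1).le
      _ = C₂ * η := by
          rw [show η ^ 5 = ε * η by rw [← hη4]; ring]
          field_simp [hε.1.ne']
      _ ≤ max C₁ C₂ * η := mul_le_mul_of_nonneg_right (le_max_right _ _) hη0.le

/-! ### Existence, comparison and trapping for scalar equations -/

/-- A bounded vector field that is Lipschitz in space and continuous in time has forward solutions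
for all times. -/
theorem exists_forward_solution {f : ℝ → ℝ → ℝ} {L M : NNReal} (hL : ∀ t, LipschitzWith L (f t))
    (hM : ∀ t x, |f t x| ≤ M) (hc : ∀ x, Continuous fun t => f t x) (t₀ x₀ : ℝ) :
    ∃ x : ℝ → ℝ, x t₀ = x₀ ∧ ∀ t ∈ Set.Ici t₀, HasDerivWithinAt x (f t (x t)) (Set.Ici t₀) t := by
  have step : ∀ n : ℕ, ∃ α : ℝ → ℝ, α t₀ = x₀ ∧ ∀ t ∈ Set.Icc t₀ (t₀ + n),
      HasDerivWithinAt α (f t (α t)) (Set.Icc t₀ (t₀ + n)) t := fun n => by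
    have hn : (0 : ℝ) ≤ n := n.cast_nonneg
    have hpl : IsPicardLindelof f (tmin := t₀) (tmax := t₀ + n) ⟨t₀, le_rfl, by linarith⟩ x₀
        (M * n) 0 M L :=
      { lipschitzOnWith := fun t _ => (hL t).lipschitzOnWith
        continuousOn := fun x _ => (hc x).continuousOn
        norm_le := fun t _ x _ => hM t x
        mul_max_le := by simp }
    exact hpl.exists_eq_forall_mem_Icc_hasDerivWithinAt₀
  choose α hα0 hα using step
  have mono : ∀ {m n : ℕ}, m ≤ n → ∀ t ∈ Set.Icc t₀ (t₀ + m),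
      HasDerivWithinAt (α n) (f t (α n t)) (Set.Icc t₀ (t₀ + m)) t := fun {m n} hmn t ht => by
    have hsub : Set.Icc t₀ (t₀ + m) ⊆ Set.Icc t₀ (t₀ + n) :=
      Set.Icc_subset_Icc_right (by have : (m : ℝ) ≤ n := by exact_mod_cast hmn
                                   linarith)
    exact (hα n t (hsub ht)).mono hsub
  have right : ∀ {m : ℕ} {β : ℝ → ℝ}, (∀ t ∈ Set.Icc t₀ (t₀ + m),
      HasDerivWithinAt β (f t (β t)) (Set.Icc t₀ (t₀ + m)) t) → ∀ t ∈ Set.Ico t₀ (t₀ + m),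
      HasDerivWithinAt β (f t (β t)) (Set.Ici t) t := fun {m β} h t ht =>
    (h t ⟨ht.1, ht.2.le⟩).mono_of_mem_nhdsWithin (Icc_mem_nhdsGE_of_mem ht)
  have agree : ∀ {m n : ℕ}, m ≤ n → Set.EqOn (α m) (α n) (Set.Icc t₀ (t₀ + m)) := fun {m n} hmn =>
    ODE_solution_unique_of_mem_Icc_right (v := f) (s := fun _ => Set.univ) (K := L)
      (fun t _ => (hL t).lipschitzOnWith)
      (fun t ht => (hα m t ht).continuousWithinAt) (right (hα m)) (fun _ _ => trivial)
      (fun t ht => (mono hmn t ht).continuousWithinAt) (right (mono hmn)) (fun _ _ => trivial)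
      ((hα0 m).trans (hα0 n).symm)
  have ceil : ∀ {t : ℝ}, t₀ ≤ t → t ∈ Set.Icc t₀ (t₀ + (⌈t - t₀⌉₊ : ℕ)) := fun {t} ht =>
    ⟨ht, by linarith [Nat.le_ceil (t - t₀)]⟩
  set x : ℝ → ℝ := fun t => α ⌈t - t₀⌉₊ t with hx
  have x_eq : ∀ n : ℕ, Set.EqOn x (α n) (Set.Icc t₀ (t₀ + n)) := fun n t ht => by
    rcases le_total ⌈t - t₀⌉₊ n with h | h
    · exact agree h (ceil ht.1)
    · exact (agree h ht).symm
  refine ⟨x, by simp [hx, hα0], fun t ht => ?_⟩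
  have hlt : t < t₀ + ((⌈t - t₀⌉₊ + 1 : ℕ) : ℝ) := by
    push_cast
    linarith [Nat.le_ceil (t - t₀)]
  have hmem : t ∈ Set.Icc t₀ (t₀ + ((⌈t - t₀⌉₊ + 1 : ℕ) : ℝ)) := ⟨ht, hlt.le⟩
  have h := (hα (⌈t - t₀⌉₊ + 1) t hmem).congr (x_eq _) (x_eq _ hmem)
  rw [← x_eq _ hmem] at h
  refine h.mono_of_mem_nhdsWithin ?_
  filter_upwards [self_mem_nhdsWithin, mem_nhdsWithin_of_mem_nhds (Iio_mem_nhds hlt)] with s h1 h2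
  exact ⟨h1, h2.le⟩

/-- Comparison with the linear equation `V̇ = -a (V - q)`. -/
theorem le_of_deriv_le_neg_mul_sub {V V' : ℝ → ℝ} {a q t₀ T : ℝ}
    (hV : ∀ t ∈ Set.Icc t₀ T, HasDerivWithinAt V (V' t) (Set.Icc t₀ T) t)
    (hle : ∀ t ∈ Set.Icc t₀ T, V' t ≤ -a * (V t - q)) :
    ∀ t ∈ Set.Icc t₀ T, V t ≤ q + (V t₀ - q) * Real.exp (-a * (t - t₀)) := by
  intro t ht
  have hW : ∀ s ∈ Set.Icc t₀ T, HasDerivWithinAt (fun s => (V s - q) * Real.exp (a * (s - t₀)))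
      ((V' s + a * (V s - q)) * Real.exp (a * (s - t₀))) (Set.Icc t₀ T) s := fun s hs => by
    have h1 : HasDerivAt (fun s => Real.exp (a * (s - t₀))) (Real.exp (a * (s - t₀)) * a) s := by
      simpa using (((hasDerivAt_id s).sub_const t₀).const_mul a).exp
    refine (((hV s hs).sub_const q).mul h1.hasDerivWithinAt).congr_deriv ?_
    ring
  have hanti : AntitoneOn (fun s => (V s - q) * Real.exp (a * (s - t₀))) (Set.Icc t₀ T) :=
    antitoneOn_of_hasDerivWithinAt_nonpos (convex_Icc _ _)
      (fun s hs => (hW s hs).continuousWithinAt)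
      (fun s hs => (hW s (interior_subset hs)).mono interior_subset)
      (fun s hs => mul_nonpos_of_nonpos_of_nonneg (by linarith [hle s (interior_subset hs)])
        (Real.exp_pos _).le)
  have h := hanti ⟨le_rfl, ht.1.trans ht.2⟩ ht ht.1
  simp only [sub_self, mul_zero, Real.exp_zero, mul_one] at h
  have h2 := mul_le_mul_of_nonneg_right h (Real.exp_pos (-a * (t - t₀))).le
  rw [mul_assoc, ← Real.exp_add, show a * (t - t₀) + -a * (t - t₀) = 0 by ring, Real.exp_zero,
    mul_one] at h2
  linarith

/-- A continuous trajectory that starts in the ball of radius `R` cannot leave it if, as long as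
it stays there, it actually stays in a smaller ball. -/
theorem mem_closedBall_of_trapped {x : ℝ → ℝ} {xs b R t₀ T : ℝ} (hb : b < R)
    (hx : ContinuousOn x (Set.Icc t₀ T)) (h0 : |x t₀ - xs| ≤ b)
    (htrap : ∀ S ∈ Set.Icc t₀ T, (∀ t ∈ Set.Icc t₀ S, x t ∈ Metric.closedBall xs R) →
      |x S - xs| ≤ b) :
    ∀ t ∈ Set.Icc t₀ T, x t ∈ Metric.closedBall xs R := by
  by_contra! hne
  obtain ⟨t₁, ht₁, hout⟩ := hne
  rw [Metric.mem_closedBall, Real.dist_eq, not_le] at hout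
  have hφ : ContinuousOn (fun t => |x t - xs|) (Set.Icc t₀ T) := (hx.sub continuousOn_const).abs
  have hsub : Set.Icc t₀ t₁ ⊆ Set.Icc t₀ T := Set.Icc_subset_Icc_right ht₁.2
  -- the first time at which the trajectory reaches the boundary
  set S : Set ℝ := Set.Icc t₀ t₁ ∩ (fun t => |x t - xs|) ⁻¹' {R}
  have hSc : IsCompact S := by
    refine isCompact_Icc.of_isClosed_subset ?_ Set.inter_subset_left
    exact (hφ.mono hsub).preimage_isClosed_of_isClosed isClosed_Icc isClosed_singleton
  have hSn : S.Nonempty := by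
    obtain ⟨s, hs, hsR⟩ := intermediate_value_Icc ht₁.1 (hφ.mono hsub)
      (show R ∈ Set.Icc _ _ from ⟨(h0.trans hb.le), hout.le⟩)
    exact ⟨s, hs, hsR⟩
  obtain ⟨s, hsS, hmin⟩ := hSc.exists_isLeast hSn
  have hsR : |x s - xs| = R := hsS.2
  have hin : ∀ t ∈ Set.Icc t₀ s, x t ∈ Metric.closedBall xs R := fun t ht => by
    rw [Metric.mem_closedBall, Real.dist_eq]
    by_contra! hlt
    have hts : t < s := lt_of_le_of_ne ht.2 (by rintro rfl; exact absurd hsR hlt.ne')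
    have htt : Set.Icc t₀ t ⊆ Set.Icc t₀ t₁ := Set.Icc_subset_Icc_right (hts.le.trans hsS.1.2)
    obtain ⟨u, hu, huR⟩ := intermediate_value_Icc ht.1 (hφ.mono (htt.trans hsub))
      (show R ∈ Set.Icc _ _ from ⟨(h0.trans hb.le), hlt.le⟩)
    exact absurd (hmin ⟨htt hu, huR⟩) (not_le.2 (hu.2.trans_lt hts))
  exact absurd (htrap s (hsub hsS.1) hin) (by rw [hsR]; exact not_le.2 hb)

/-- The inequality behind the Lyapunov function `(z - xs) ^ 2`: here `y` and `ζ` are the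
displacements of `x` and `z`, the numbers `F` and `ζ'` the averaged field at `x` and the derivative
of `z`. -/
theorem dissipation_of_close {y ζ F ζ' lam r h A M : ℝ} (hlam : 0 < lam)
    (hd : y * F ≤ -lam * (y ^ 2 - r ^ 2)) (hF : |F| ≤ M) (he : |ζ - y| ≤ h) (he' : |ζ' - F| ≤ h)
    (hζ : |ζ| ≤ A) :
    2 * ζ * ζ' ≤ -(2 * lam) * (ζ ^ 2 - (r ^ 2 + (M + A * (1 + 2 * lam)) * h / lam)) := by
  have hh0 : 0 ≤ h := (abs_nonneg _).trans he
  have hA0 : 0 ≤ A := (abs_nonneg _).trans hζ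
  have t1 : (ζ - y) * F ≤ h * M :=
    (le_abs_self _).trans (by rw [abs_mul]; exact mul_le_mul he hF (abs_nonneg _) hh0)
  have t2 : ζ * (ζ' - F) ≤ A * h :=
    (le_abs_self _).trans (by rw [abs_mul]; exact mul_le_mul hζ he' (abs_nonneg _) hA0)
  have t3 : ζ * (ζ - y) ≤ A * h :=
    (le_abs_self _).trans (by rw [abs_mul]; exact mul_le_mul hζ he (abs_nonneg _) hA0)
  have t4 : ζ ^ 2 ≤ y ^ 2 + 2 * (A * h) := by
    nlinarith [sq_nonneg (ζ - y)]
  have t5 := mul_le_mul_of_nonneg_left t4 hlam.le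
  have e : -(2 * lam) * (ζ ^ 2 - (r ^ 2 + (M + A * (1 + 2 * lam)) * h / lam)) =
      -(2 * lam) * (ζ ^ 2 - r ^ 2) + 2 * ((M + A * (1 + 2 * lam)) * h) := by
    field_simp
    ring
  rw [e]
  linarith

/-- Dissipativity of the averaged field gives an exponential estimate, up to a small error, for
the trajectories that stay in a given compact ball. -/
theorem IsAveragedBy.exists_norm_sub_le {G : ℝ → ℝ → ℝ → ℝ} {D : Set ℝ} {F : ℝ → ℝ}
    (hG : IsAveragedBy G D F) (hF : ContinuousOn F D) {xs R lam r : ℝ}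
    (hR : Metric.closedBall xs R ⊆ D) (hlam : 0 < lam) (hr : 0 ≤ r)
    (hdiss : ∀ x ∈ D, (x - xs) * F x ≤ -lam * ((x - xs) ^ 2 - r ^ 2)) {ρ : ℝ} (hρ : 0 < ρ) :
    ∃ εbar > 0, ∀ ε ∈ Set.Ioo 0 εbar, ∀ (t₀ T : ℝ) (x : ℝ → ℝ),
      IsSolutionOn (G ε) D (Set.Icc t₀ T) x →
      (∀ t ∈ Set.Icc t₀ T, x t ∈ Metric.closedBall xs R) → ∀ t ∈ Set.Icc t₀ T,
        |x t - xs| ≤ |x t₀ - xs| * Real.exp (-lam * (t - t₀)) + r + ρ := by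
  obtain ⟨C', hC'⟩ := hG _ hR (isCompact_closedBall xs R)
  obtain ⟨M', hM'⟩ := (isCompact_closedBall xs R).exists_bound_of_continuousOn (hF.mono hR)
  set C := max C' 0 with hCdef
  set M := max M' 0 with hMdef
  have hC0 : 0 ≤ C := le_max_right _ _
  have hM0 : 0 ≤ M := le_max_right _ _
  set B := M + (|R| + C) * (1 + 2 * lam) with hBdef
  have hB0 : 0 ≤ B := by positivity
  have hlim : Filter.Tendsto (fun ε : ℝ => 2 * (C * ε ^ (1 / 4 : ℝ)) +
      Real.sqrt (B * (C * ε ^ (1 / 4 : ℝ)) / lam)) (nhdsWithin 0 (Set.Ioi 0)) (nhds 0) := by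
    have hc : ContinuousAt (fun ε : ℝ => 2 * (C * ε ^ (1 / 4 : ℝ)) +
        Real.sqrt (B * (C * ε ^ (1 / 4 : ℝ)) / lam)) 0 := by
      have h1 : ContinuousAt (fun ε : ℝ => ε ^ (1 / 4 : ℝ)) 0 :=
        Real.continuousAt_rpow_const _ _ (Or.inr (by norm_num))
      have h2 : ContinuousAt (fun ε : ℝ => C * ε ^ (1 / 4 : ℝ)) 0 := h1.const_mul C
      exact (h2.const_mul 2).add ((h2.const_mul B).div_const lam).sqrt
    have h0 := hc.tendsto
    rw [Real.zero_rpow (by norm_num)] at h0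
    simp only [mul_zero, zero_div, Real.sqrt_zero, add_zero] at h0
    exact h0.mono_left nhdsWithin_le_nhds
  obtain ⟨ε₁, hε₁, hsmall⟩ :=
    mem_nhdsGT_iff_exists_Ioo_subset.1 (hlim.eventually (gt_mem_nhds hρ))
  refine ⟨min ε₁ 1, lt_min hε₁ one_pos, fun ε hε t₀ T x hx hxR t ht => ?_⟩
  have hε0 : 0 < ε := hε.1
  have hε1 : ε < 1 := hε.2.trans_le (min_le_right _ _)
  have hερ := hsmall (show ε ∈ Set.Ioo 0 ε₁ from ⟨hε0, hε.2.trans_le (min_le_left _ _)⟩)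
  obtain ⟨z, z', hz⟩ := hC' ε ⟨hε0, hε1.le⟩ _ x hxR hx
  simp only [Set.mem_ofPred_eq] at hερ
  set η := ε ^ (1 / 4 : ℝ) with hη
  have hη0 : 0 < η := Real.rpow_pos_of_pos hε0 _
  have hη1 : η ≤ 1 := Real.rpow_le_one hε0.le hε1.le (by norm_num)
  set h := C * η with hh
  have hh0 : 0 ≤ h := by positivity
  have hhC : h ≤ C := mul_le_of_le_one_right hC0 hη1
  have hzx : ∀ s ∈ Set.Icc t₀ T, |z s - x s| ≤ h := fun s hs =>
    (hz s hs).2.1.trans (mul_le_mul_of_nonneg_right (le_max_left _ _) hη0.le)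
  have hz'F : ∀ s ∈ Set.Icc t₀ T, |z' s - F (x s)| ≤ h := fun s hs =>
    (hz s hs).2.2.trans (mul_le_mul_of_nonneg_right (le_max_left _ _) hη0.le)
  have hV : ∀ s ∈ Set.Icc t₀ T, HasDerivWithinAt (fun s => (z s - xs) ^ 2)
      (2 * (z s - xs) * z' s) (Set.Icc t₀ T) s := fun s hs => by
    refine (((hz s hs).1.sub_const xs).pow 2).congr_deriv ?_
    norm_num
  have hq : ∀ s ∈ Set.Icc t₀ T, 2 * (z s - xs) * z' s ≤
      -(2 * lam) * ((z s - xs) ^ 2 - (r ^ 2 + B * h / lam)) := fun s hs => by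
    have hxs := hxR s hs
    rw [Metric.mem_closedBall, Real.dist_eq] at hxs
    have hd := hdiss (x s) (hR (hxR s hs))
    have hFM : |F (x s)| ≤ M := (hM' _ (hxR s hs)).trans (le_max_left _ _)
    have he : |(z s - xs) - (x s - xs)| ≤ h := by rw [sub_sub_sub_cancel_right]; exact hzx s hs
    have he' := hz'F s hs
    have hζ : |z s - xs| ≤ |R| + C := by
      calc |z s - xs| = |(z s - x s) + (x s - xs)| := by congr 1; ring
        _ ≤ h + R := (abs_add_le _ _).trans (add_le_add (hzx s hs) hxs)
        _ ≤ |R| + C := by linarith [le_abs_self R]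
    exact dissipation_of_close hlam hd hFM he he' hζ
  have hmain := le_of_deriv_le_neg_mul_sub hV hq t ht
  have ht₀ : t₀ ∈ Set.Icc t₀ T := ⟨le_rfl, ht.1.trans ht.2⟩
  set E := Real.exp (-lam * (t - t₀)) with hE
  have hE0 : 0 < E := Real.exp_pos _
  have hE1 : E ≤ 1 := Real.exp_le_one_iff.2 (by nlinarith [ht.1])
  have hEE : Real.exp (-(2 * lam) * (t - t₀)) = E ^ 2 := by
    rw [hE, ← Real.exp_nat_mul]
    congr 1
    push_cast
    ring
  have hBh : 0 ≤ B * h / lam := by positivity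
  set σ := Real.sqrt (B * h / lam) with hσ
  have hσ0 : 0 ≤ σ := Real.sqrt_nonneg _
  have hσ2 : σ ^ 2 = B * h / lam := Real.sq_sqrt hBh
  rw [hEE] at hmain
  have hsq : (z t - xs) ^ 2 ≤ (|z t₀ - xs| * E + r + σ) ^ 2 := by
    have h0 : 0 ≤ |z t₀ - xs| * E := by positivity
    have : (|z t₀ - xs| * E) ^ 2 = (z t₀ - xs) ^ 2 * E ^ 2 := by rw [mul_pow, sq_abs]
    have h1 : 0 ≤ (r ^ 2 + σ ^ 2) * E ^ 2 := by positivity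
    have h2 := mul_nonneg h0 hr
    have h3 := mul_nonneg h0 hσ0
    have h4 := mul_nonneg hr hσ0
    rw [← hσ2] at hmain
    linarith
  have hζt : |z t - xs| ≤ |z t₀ - xs| * E + r + σ :=
    abs_le_of_sq_le_sq hsq (by positivity)
  have h1 : |x t - xs| ≤ |z t - xs| + h := by
    calc |x t - xs| = |(z t - xs) - (z t - x t)| := by congr 1; ring
      _ ≤ |z t - xs| + |z t - x t| := abs_sub _ _
      _ ≤ _ := by linarith [hzx t ht]
  have h2 : |z t₀ - xs| ≤ |x t₀ - xs| + h := by
    calc |z t₀ - xs| = |(z t₀ - x t₀) + (x t₀ - xs)| := by congr 1; ring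
      _ ≤ |z t₀ - x t₀| + |x t₀ - xs| := abs_add_le _ _
      _ ≤ _ := by linarith [hzx t₀ ht₀]
  have h3 : |z t₀ - xs| * E ≤ |x t₀ - xs| * E + h := by
    have h4 := mul_le_mul_of_nonneg_right h2 hE0.le
    have h5 := mul_le_of_le_one_right hh0 hE1
    linarith
  linarith

/-! ### Practical stability from dissipativity of the averaged field -/

/-- Truncation of the space variable to the interval `[xs - R, xs + R]`. -/
noncomputable def truncate (xs R x : ℝ) : ℝ := max (xs - R) (min (xs + R) x)

theorem truncate_mem {xs R : ℝ} (hR : 0 ≤ R) (x : ℝ) :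
    truncate xs R x ∈ Metric.closedBall xs R := by
  rw [Real.closedBall_eq_Icc]
  exact ⟨le_max_left _ _, max_le (by linarith) (min_le_left _ _)⟩

theorem truncate_of_mem {xs R x : ℝ} (hx : x ∈ Metric.closedBall xs R) : truncate xs R x = x := by
  rw [Real.closedBall_eq_Icc] at hx
  rw [truncate, min_eq_right hx.2, max_eq_right hx.1]

theorem lipschitzWith_truncate (xs R : ℝ) : LipschitzWith 1 (truncate xs R) :=
  (LipschitzWith.id.const_min (xs + R)).const_max (xs - R)

/-- Regularity of a time-varying vector field on closed balls in `D`, uniform in time: it is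
continuous in time, bounded, and Lipschitz in space. -/
def IsRegularField (f : ℝ → ℝ → ℝ) (D : Set ℝ) : Prop :=
  ∀ xs R, Metric.closedBall xs R ⊆ D → ∃ L M : NNReal,
    (∀ t, LipschitzOnWith L (f t) (Metric.closedBall xs R)) ∧
      (∀ t, ∀ x ∈ Metric.closedBall xs R, |f t x| ≤ M) ∧
        ∀ x ∈ Metric.closedBall xs R, Continuous fun t => f t x

/-- Truncation of the space variable makes the field globally Lipschitz and bounded. -/
theorem IsRegularField.exists_truncated_solution {f : ℝ → ℝ → ℝ} {D : Set ℝ}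
    (hf : IsRegularField f D) {xs R : ℝ} (hR : 0 ≤ R) (hRD : Metric.closedBall xs R ⊆ D)
    (t₀ x₀ : ℝ) : ∃ x : ℝ → ℝ, x t₀ = x₀ ∧ ∀ t ∈ Set.Ici t₀,
      HasDerivWithinAt x (f t (truncate xs R (x t))) (Set.Ici t₀) t := by
  obtain ⟨L, M, hL, hM, hc⟩ := hf xs R hRD
  refine exists_forward_solution (f := fun t x => f t (truncate xs R x)) (L := L * 1) (M := M)
    (fun t => ?_) (fun t x => hM t _ (truncate_mem hR x)) (fun x => hc _ (truncate_mem hR x)) t₀ x₀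
  have h := (hL t).comp (lipschitzWith_truncate xs R).lipschitzOnWith
    (s := Set.univ) (fun x _ => truncate_mem hR x)
  exact lipschitzOnWith_univ.1 h

/-- Averaging: if the averaged field is dissipative outside the ball of radius `r`, then for small
`ε` all solutions exist for all times and satisfy an exponential estimate. -/
theorem IsAveragedBy.solutionsSatisfy {G : ℝ → ℝ → ℝ → ℝ} {D : Set ℝ} {F : ℝ → ℝ}
    (hG : IsAveragedBy G D F) (hF : ContinuousOn F D) (hreg : ∀ ε, IsRegularField (G ε) D)
    {xs δ R lam r : ℝ} (hR : Metric.closedBall xs R ⊆ D) (hlam : 0 < lam) (hr : 0 ≤ r)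
    (hdiss : ∀ x ∈ D, (x - xs) * F x ≤ -lam * ((x - xs) ^ 2 - r ^ 2)) {ρ : ℝ} (hρ : 0 < ρ)
    (hδ : δ + r + ρ ≤ R) :
    ∃ εbar > 0, ∀ ε ∈ Set.Ioo 0 εbar, ∀ (t₀ : ℝ), ∀ x₀ ∈ Metric.ball xs δ,
      SolutionsSatisfy (G ε) D t₀ x₀ fun t y =>
        |y - xs| ≤ |x₀ - xs| * Real.exp (-lam * (t - t₀)) + r + ρ := by
  obtain ⟨εbar, hε0, hε⟩ := hG.exists_norm_sub_le hF hR hlam hr hdiss hρ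
  refine ⟨εbar, hε0, fun ε hεε t₀ x₀ hx₀ => ?_⟩
  rw [Metric.mem_ball, Real.dist_eq] at hx₀
  -- a trajectory of the field, followed only while it is in the ball, never leaves the ball
  have key : ∀ (T : ℝ) (x : ℝ → ℝ), x t₀ = x₀ → ContinuousOn x (Set.Icc t₀ T) →
      (∀ t ∈ Set.Icc t₀ T, x t ∈ Metric.closedBall xs R →
        HasDerivWithinAt x (G ε t (x t)) (Set.Icc t₀ T) t) →
      ∀ t ∈ Set.Icc t₀ T, x t ∈ Metric.closedBall xs R := fun T x hx0 hxc hx => by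
    refine mem_closedBall_of_trapped (b := |x₀ - xs| + r + ρ) (by linarith) hxc
      (by rw [hx0]; linarith) fun S hS hin => ?_
    have hsub : Set.Icc t₀ S ⊆ Set.Icc t₀ T := Set.Icc_subset_Icc_right hS.2
    have h := hε ε hεε t₀ S x (fun t ht => ⟨hR (hin t ht), (hx t (hsub ht) (hin t ht)).mono hsub⟩)
      hin S ⟨hS.1, le_rfl⟩
    rw [hx0] at h
    have hexp : Real.exp (-lam * (S - t₀)) ≤ 1 := Real.exp_le_one_iff.2 (by nlinarith [hS.1])
    linarith [mul_le_of_le_one_right (abs_nonneg (x₀ - xs)) hexp]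
  constructor
  · obtain ⟨x, hx0, hx⟩ := (hreg ε).exists_truncated_solution
      (by linarith [abs_nonneg (x₀ - xs)] : 0 ≤ R) hR t₀ x₀
    have hin : ∀ t ∈ Set.Ici t₀, x t ∈ Metric.closedBall xs R := fun t ht =>
      key t x hx0 (fun s hs => ((hx s hs.1).mono fun u hu => hu.1).continuousWithinAt)
        (fun s hs hs' => by
          have h := (hx s hs.1).mono fun u (hu : u ∈ Set.Icc t₀ t) => hu.1
          rwa [truncate_of_mem hs'] at h) t ⟨ht, le_rfl⟩
    refine ⟨x, hx0, fun t ht => ⟨hR (hin t ht), ?_⟩⟩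
    have h := hx t ht
    rwa [truncate_of_mem (hin t ht)] at h
  · intro T hT x hx0 hx t ht
    have h := hε ε hεε t₀ T x hx (key T x hx0 (fun s hs => (hx s hs).2.continuousWithinAt)
      fun s hs _ => (hx s hs).2) t ht
    rwa [hx0] at h

theorem exists_closedBall_subset {D : Set ℝ} (hD : IsOpen D) {xs δ : ℝ} (hδ : 0 < δ)
    (h : Metric.closedBall xs δ ⊆ D) : ∃ R > δ, Metric.closedBall xs R ⊆ D := by
  obtain ⟨s, hs, hsD⟩ := (isCompact_closedBall xs δ).exists_cthickening_subset_open hD h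
  rw [cthickening_closedBall hs.le hδ.le] at hsD
  exact ⟨s + δ, by linarith, hsD⟩

theorem SolutionsSatisfy.mono {f : ℝ → ℝ → ℝ} {D : Set ℝ} {t₀ x₀ : ℝ} {P Q : ℝ → ℝ → Prop}
    (h : SolutionsSatisfy f D t₀ x₀ P) (hPQ : ∀ t y, t₀ ≤ t → P t y → Q t y) :
    SolutionsSatisfy f D t₀ x₀ Q :=
  ⟨h.1, fun T hT x hx0 hx t ht => hPQ t _ ht.1 (h.2 T hT x hx0 hx t ht)⟩

section Stability

variable {G : ℝ → ℝ → ℝ → ℝ} {D : Set ℝ} {F : ℝ → ℝ} {xs : ℝ}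

theorem IsAveragedBy.practicallyExponentiallyStable (hG : IsAveragedBy G D F) (hD : IsOpen D)
    (hF : ContinuousOn F D) (hreg : ∀ ε, IsRegularField (G ε) D) {lam : ℝ} (hlam : 0 < lam)
    (hdiss : ∀ x ∈ D, (x - xs) * F x ≤ -lam * (x - xs) ^ 2) :
    PracticallyExponentiallyStable G D xs := by
  refine ⟨1, one_pos, lam, hlam, fun δ hδ hδD ρ hρ => ?_⟩
  obtain ⟨R, hRδ, hR⟩ := exists_closedBall_subset hD hδ hδD
  obtain ⟨εbar, h0, h⟩ := hG.solutionsSatisfy hF hreg (δ := δ) (r := 0) hR hlam le_rfl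
    (fun x hx => by simpa using hdiss x hx) (lt_min hρ (sub_pos.2 hRδ))
    (by linarith [min_le_right ρ (R - δ)])
  refine ⟨εbar, h0, fun ε hε t₀ _ x₀ hx₀ => (h ε hε t₀ x₀ hx₀).mono fun t y _ hy => ?_⟩
  linarith [min_le_left ρ (R - δ)]

theorem IsAveragedBy.practicallyAsymptoticallyStable (hG : IsAveragedBy G D F) (hD : IsOpen D)
    (hxs : xs ∈ D) (hF : ContinuousOn F D) (hreg : ∀ ε, IsRegularField (G ε) D)
    (hdiss : ∀ r > 0, ∃ lam > 0, ∀ x ∈ D, (x - xs) * F x ≤ -lam * ((x - xs) ^ 2 - r ^ 2)) :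
    PracticallyAsymptoticallyStable G D xs := by
  constructor
  · intro ρ hρ
    obtain ⟨s, hs, hsD⟩ := Metric.nhds_basis_closedBall.mem_iff.1 (hD.mem_nhds hxs)
    have hσ : 0 < min ρ s := lt_min hρ hs
    set σ := min ρ s with hσdef
    obtain ⟨lam, hlam, hl⟩ := hdiss (σ / 4) (by positivity)
    obtain ⟨εbar, h0, h⟩ := hG.solutionsSatisfy hF hreg (δ := σ / 4) (R := σ) (ρ := σ / 4)
      ((Metric.closedBall_subset_closedBall (min_le_right ρ s)).trans hsD) hlam (by positivity) hl
      (by positivity) (by linarith)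
    refine ⟨σ / 4, by positivity, εbar, h0, fun ε hε t₀ _ x₀ hx₀ =>
      (h ε hε t₀ x₀ hx₀).mono fun t y ht hy => ?_⟩
    rw [Metric.mem_ball, Real.dist_eq] at hx₀ ⊢
    have hexp : Real.exp (-lam * (t - t₀)) ≤ 1 := Real.exp_le_one_iff.2 (by nlinarith)
    linarith [mul_le_of_le_one_right (abs_nonneg (x₀ - xs)) hexp, min_le_left ρ s]
  · intro δ hδ hδD ρ hρ
    obtain ⟨R, hRδ, hR⟩ := exists_closedBall_subset hD hδ hδD
    have hσ : 0 < min ρ (R - δ) := lt_min hρ (sub_pos.2 hRδ)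
    set σ := min ρ (R - δ) with hσdef
    obtain ⟨lam, hlam, hl⟩ := hdiss (σ / 4) (by positivity)
    obtain ⟨εbar, h0, h⟩ := hG.solutionsSatisfy hF hreg (δ := δ) (ρ := σ / 4) hR hlam
      (by positivity) hl (by positivity) (by linarith [min_le_right ρ (R - δ)])
    -- after the time `τ` the exponential term has shrunk to `σ / 4`
    obtain ⟨τ, hτ0, hτ⟩ : ∃ τ ≥ 0, δ * Real.exp (-lam * τ) ≤ σ / 4 := by
      refine ⟨max 0 (Real.log (4 * δ / σ) / lam), le_max_left _ _, ?_⟩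
      have h1 : Real.log (4 * δ / σ) ≤ lam * max 0 (Real.log (4 * δ / σ) / lam) := by
        have h2 := mul_le_mul_of_nonneg_left
          (le_max_right 0 (Real.log (4 * δ / σ) / lam)) hlam.le
        rwa [mul_div_cancel₀ _ hlam.ne'] at h2
      have h3 : Real.exp (-lam * max 0 (Real.log (4 * δ / σ) / lam)) ≤ (4 * δ / σ)⁻¹ := by
        rw [← Real.exp_log (by positivity : 0 < (4 * δ / σ)⁻¹), Real.log_inv]
        exact Real.exp_le_exp.2 (by linarith)
      refine (mul_le_mul_of_nonneg_left h3 hδ.le).trans (le_of_eq ?_)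
      field_simp
    refine ⟨τ, hτ0, εbar, h0, fun ε hε t₀ _ x₀ hx₀ =>
      (h ε hε t₀ x₀ hx₀).mono fun t y ht hy hτt => ?_⟩
    rw [Metric.mem_ball, Real.dist_eq] at hx₀ ⊢
    have hexp : Real.exp (-lam * (t - t₀)) ≤ Real.exp (-lam * τ) :=
      Real.exp_le_exp.2 (by nlinarith)
    have h4 := mul_le_mul hx₀.le hexp (Real.exp_pos _).le hδ.le
    linarith [min_le_left ρ (R - δ)]

end Stability

/-! ### Regularity of the system and dissipativity for polynomial-like costs -/

theorem exists_lipschitz_bound {D : Set ℝ} (hD : IsOpen D) {h : ℝ → ℝ} (hh : ContDiffOn ℝ 1 h D)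
    {xs R : ℝ} (hR : Metric.closedBall xs R ⊆ D) : ∃ C, 0 ≤ C ∧
      (∀ x ∈ Metric.closedBall xs R, |h x| ≤ C) ∧
        ∀ x ∈ Metric.closedBall xs R, ∀ y ∈ Metric.closedBall xs R, |h x - h y| ≤ C * |x - y| := by
  have hK := isCompact_closedBall xs R
  obtain ⟨A, hA⟩ := hK.exists_bound_of_continuousOn (hh.continuousOn.mono hR)
  obtain ⟨B, hB⟩ := hK.exists_bound_of_continuousOn
    ((hh.continuousOn_deriv_of_isOpen hD le_rfl).mono hR)
  refine ⟨max 0 (max A B), le_max_left _ _,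
    fun x hx => (hA x hx).trans ((le_max_left _ _).trans (le_max_right _ _)),
    fun x hx y hy => ?_⟩
  have hdiff : ∀ z ∈ Metric.closedBall xs R, HasDerivWithinAt h (deriv h z)
      (Metric.closedBall xs R) z := fun z hz =>
    ((hh.differentiableOn (by norm_num)).differentiableAt
      (hD.mem_nhds (hR hz))).hasDerivAt.hasDerivWithinAt
  exact (convex_closedBall xs R).norm_image_sub_le_of_norm_hasDerivWithin_le hdiff
    (fun z hz => (hB z hz).trans ((le_max_right _ _).trans (le_max_right _ _))) hy hx

theorem continuous_input (κ κ' : ℤ) (ε : ℝ) (k : Fin 4) : Continuous fun t => input κ κ' ε t k := by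
  fin_cases k <;> simp [input, ditherFst12, ditherSnd12, ditherFst1222, ditherSnd1222] <;> fun_prop

theorem exists_abs_input_le (κ κ' : ℤ) (ε : ℝ) (k : Fin 4) : ∃ U, ∀ t, |input κ κ' ε t k| ≤ U := by
  have trig : ∀ (a b : ℝ) {y : ℝ}, |y| ≤ 1 → |a * (b * y)| ≤ |a * b| := fun a b y hy => by
    rw [← mul_assoc, abs_mul]
    exact mul_le_of_le_one_right (abs_nonneg _) hy
  fin_cases k
  · exact ⟨_, fun t => trig _ _ (Real.abs_cos_le_one _)⟩
  · exact ⟨_, fun t => trig _ _ (Real.abs_sin_le_one _)⟩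
  · exact ⟨_, fun t => trig _ _ (Real.abs_sin_le_one _)⟩
  · exact ⟨_, fun t => trig _ _ (Real.abs_cos_le_one _)⟩

theorem isRegularField_esField {D : Set ℝ} (hD : IsOpen D) {g : Fin 4 → ℝ → ℝ} {J : ℝ → ℝ}
    (hg : ∀ k, ContDiffOn ℝ 4 (g k ∘ J) D) (κ κ' : ℤ) (ε : ℝ) :
    IsRegularField (esField g J κ κ' ε) D := by
  intro xs R hR
  have hg1 : ∀ k, ContDiffOn ℝ 1 (g k ∘ J) D := fun k => (hg k).of_le (by norm_num)
  choose C hC0 hC hCL using fun k => exists_lipschitz_bound hD (hg1 k) hR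
  choose U hU using exists_abs_input_le κ κ' ε
  have hU0 : ∀ k, 0 ≤ U k := fun k => (abs_nonneg _).trans (hU k 0)
  have hS : 0 ≤ ∑ k, C k * U k := Finset.sum_nonneg fun k _ => mul_nonneg (hC0 k) (hU0 k)
  obtain ⟨S, hSe⟩ : ∃ S : NNReal, (S : ℝ) = ∑ k, C k * U k := ⟨⟨_, hS⟩, rfl⟩
  refine ⟨S, S, fun t => ?_, fun t x hx => ?_, fun x _ => ?_⟩
  · refine LipschitzOnWith.of_dist_le_mul fun x hx y hy => ?_
    rw [Real.dist_eq, Real.dist_eq, hSe, esField, esField, ← Finset.sum_sub_distrib, Finset.sum_mul]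
    refine (Finset.abs_sum_le_sum_abs _ _).trans (Finset.sum_le_sum fun k _ => ?_)
    rw [← sub_mul, abs_mul, mul_right_comm]
    exact mul_le_mul (hCL k x hx y hy) (hU k t) (abs_nonneg _)
      (mul_nonneg (hC0 k) (abs_nonneg _))
  · rw [hSe]
    refine (Finset.abs_sum_le_sum_abs _ _).trans (Finset.sum_le_sum fun k _ => ?_)
    rw [abs_mul]
    exact mul_le_mul (hC k x hx) (hU k t) (abs_nonneg _) (hC0 k)
  · exact continuous_finsetSum _ fun k _ => (continuous_input κ κ' ε k).const_mul _

/-- Integration of a power bound on the derivative, with the crude constant. -/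
theorem abs_le_pow_succ_of_abs_deriv_le {h h' : ℝ → ℝ} {xs r c : ℝ} (hc : 0 ≤ c) (k : ℕ)
    (hd : ∀ x ∈ Metric.ball xs r, HasDerivAt h (h' x) x)
    (hle : ∀ x ∈ Metric.ball xs r, |h' x| ≤ c * |x - xs| ^ k) :
    ∀ x ∈ Metric.ball xs r, |h x - h xs| ≤ c * |x - xs| ^ (k + 1) := by
  intro x hx
  have hsub : Metric.closedBall xs |x - xs| ⊆ Metric.ball xs r :=
    Metric.closedBall_subset_ball (by simpa [Real.dist_eq] using hx)
  have hbd : ∀ y ∈ Metric.closedBall xs |x - xs|, ‖h' y‖ ≤ c * |x - xs| ^ k := fun y hy => by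
    refine (hle y (hsub hy)).trans (mul_le_mul_of_nonneg_left ?_ hc)
    rw [Metric.mem_closedBall, Real.dist_eq] at hy
    exact pow_le_pow_left₀ (abs_nonneg _) hy k
  have := (convex_closedBall xs |x - xs|).norm_image_sub_le_of_norm_hasDerivWithin_le
    (fun y hy => (hd y (hsub hy)).hasDerivWithinAt) hbd
    (Metric.mem_closedBall_self (abs_nonneg _)) (by simp [Real.dist_eq] : x ∈ _)
  rw [Real.norm_eq_abs, Real.norm_eq_abs] at this
  rw [pow_succ, ← mul_assoc]
  exact this

/-- If `J` grows exactly like a quartic at `xs`, then near `xs` the third derivative, multiplied by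
the displacement, is bounded below by a positive multiple of the squared displacement: the fourth
derivative at `xs` cannot vanish. -/
theorem PolynomialLike.exists_third_deriv_lower {J : ℝ → ℝ} {D : Set ℝ} (hD : IsOpen D) {xs : ℝ}
    (hxs : xs ∈ D) {α₁ α₂ β₁₁ β₁₂ β₂₁ β₂₂ : ℝ}
    (hJ : PolynomialLike J D xs 4 α₁ α₂ β₁₁ β₁₂ β₂₁ β₂₂) :
    ∃ c > 0, ∃ r > 0, ∀ x ∈ Metric.ball xs r,
      c * (x - xs) ^ 2 ≤ iteratedDeriv 3 J x * (x - xs) := by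
  have hsmooth : ∀ k n : ℕ, n + k ≤ 4 → ContDiffOn ℝ n (iteratedDeriv k J) D := by
    intro k
    induction k with
    | zero =>
      intro n hn
      rw [iteratedDeriv_zero]
      exact hJ.contDiffOn.of_le (by exact_mod_cast hn)
    | succ k ih =>
      intro n hn
      rw [iteratedDeriv_succ]
      exact (ih (n + 1) (by omega)).deriv_of_isOpen hD (by push_cast; rfl)
  have hderiv : ∀ k < 4, ∀ x ∈ D,
      HasDerivAt (iteratedDeriv k J) (iteratedDeriv (k + 1) J x) x := fun k hk x hx => by
    have h1 := hsmooth k 1 (by omega)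
    rw [iteratedDeriv_succ]
    exact ((h1.differentiableOn (by norm_num)).differentiableAt (hD.mem_nhds hx)).hasDerivAt
  have hsign : ∀ x ∈ D, 0 ≤ iteratedDeriv 3 J x * (x - xs) := fun x hx =>
    (mul_nonneg hJ.β₂₁_nonneg (by positivity)).trans (hJ.deriv3_lower x hx)
  have hDn : ∀ᶠ x in nhds xs, x ∈ D := hD.mem_nhds hxs
  -- the first, second and third derivatives vanish at `xs`
  have h1 : iteratedDeriv 1 J xs = 0 := by
    have := hJ.deriv_upper xs hxs
    simpa using this
  have h2 : iteratedDeriv 2 J xs = 0 := by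
    have hO : (iteratedDeriv 1 J) =O[nhds xs] fun x => ‖x - xs‖ ^ 3 := by
      refine Asymptotics.IsBigO.of_bound β₁₂ ?_
      filter_upwards [hDn] with x hx
      have := hJ.deriv_upper x hx
      simpa using this
    have h0 : HasDerivAt (iteratedDeriv 1 J) 0 xs := by
      have := (hO.hasFDerivAt (𝕜 := ℝ) (by norm_num)).hasDerivAt
      simpa using this
    exact (hderiv 1 (by norm_num) xs hxs).unique h0
  have h3 : iteratedDeriv 3 J xs = 0 := by
    have hc : ContinuousAt (iteratedDeriv 3 J) xs :=
      (hderiv 3 (by norm_num) xs hxs).continuousAt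
    apply le_antisymm
    · refine le_of_tendsto (hc.tendsto.mono_left (nhdsWithin_le_nhds (s := Set.Iio xs))) ?_
      filter_upwards [mem_nhdsWithin_of_mem_nhds hDn, self_mem_nhdsWithin] with x hx hlt
      exact nonpos_of_mul_nonneg_left (hsign x hx) (sub_neg.2 hlt)
    · refine ge_of_tendsto (hc.tendsto.mono_left (nhdsWithin_le_nhds (s := Set.Ioi xs))) ?_
      filter_upwards [mem_nhdsWithin_of_mem_nhds hDn, self_mem_nhdsWithin] with x hx hlt
      exact nonneg_of_mul_nonneg_left (hsign x hx) (sub_pos.2 hlt)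
  set a := iteratedDeriv 4 J xs with ha
  have happrox : ∀ c > 0, ∃ r > 0, ∀ x ∈ Metric.ball xs r, x ∈ D ∧
      |iteratedDeriv 3 J x - a * (x - xs)| ≤ c * |x - xs| := fun c hc => by
    have hlo := (hasDerivAt_iff_isLittleO.1 (hderiv 3 (by norm_num) xs hxs)).def hc
    obtain ⟨r, hr, hball⟩ := Metric.eventually_nhds_iff_ball.1 (hDn.and hlo)
    refine ⟨r, hr, fun x hx => ⟨(hball x hx).1, ?_⟩⟩
    have := (hball x hx).2
    rw [h3, smul_eq_mul, sub_zero, mul_comm (x - xs)] at this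
    exact this
  -- otherwise `J` would grow too slowly to be bounded below by `α₁ |x - xs| ^ 4`
  have hapos : 0 < a := by
    by_contra! hneg
    have hα := hJ.α₁_pos
    obtain ⟨r, hr, hball⟩ := happrox (α₁ / 2) (by positivity)
    have b3 : ∀ x ∈ Metric.ball xs r, |iteratedDeriv 3 J x| ≤ α₁ / 2 * |x - xs| ^ 1 :=
      fun x hx => by
        obtain ⟨hxD, hle⟩ := hball x hx
        have hs := hsign x hxD
        obtain ⟨l, u⟩ := abs_le.1 hle
        rw [pow_one]
        rcases lt_trichotomy x xs with h | rfl | h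
        · have hn : x - xs < 0 := sub_neg.2 h
          have h5 := nonpos_of_mul_nonneg_left hs hn
          rw [abs_of_neg hn] at l u ⊢
          rw [abs_of_nonpos h5]
          nlinarith [mul_nonneg_of_nonpos_of_nonpos hneg hn.le]
        · simp [h3]
        · have hp : 0 < x - xs := sub_pos.2 h
          have h5 := nonneg_of_mul_nonneg_left hs hp
          rw [abs_of_pos hp] at l u ⊢
          rw [abs_of_nonneg h5]
          nlinarith [mul_nonpos_of_nonpos_of_nonneg hneg hp.le]
    have hd : ∀ k < 4, ∀ x ∈ Metric.ball xs r,
        HasDerivAt (iteratedDeriv k J) (iteratedDeriv (k + 1) J x) x :=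
      fun k hk x hx => hderiv k hk x (hball x hx).1
    have b2 := abs_le_pow_succ_of_abs_deriv_le (by positivity) 1 (hd 2 (by norm_num)) b3
    simp only [h2, sub_zero] at b2
    have b1 := abs_le_pow_succ_of_abs_deriv_le (by positivity) 2 (hd 1 (by norm_num)) b2
    simp only [h1, sub_zero] at b1
    have b0 := abs_le_pow_succ_of_abs_deriv_le (by positivity) 3 (hd 0 (by norm_num)) b1
    simp only [iteratedDeriv_zero] at b0
    have hx : xs + r / 2 ∈ Metric.ball xs r := by
      rw [Metric.mem_ball, Real.dist_eq, add_sub_cancel_left, abs_of_pos (by positivity)]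
      linarith
    have hlow := hJ.lower _ (hball _ hx).1
    have hup : J (xs + r / 2) - J xs ≤ α₁ / 2 * |xs + r / 2 - xs| ^ 4 :=
      (le_abs_self _).trans (b0 _ hx)
    have hpos : 0 < |xs + r / 2 - xs| ^ 4 := by
      rw [add_sub_cancel_left]
      positivity
    nlinarith
  obtain ⟨r, hr, hball⟩ := happrox (a / 2) (by positivity)
  refine ⟨a / 2, by positivity, r, hr, fun x hx => ?_⟩
  have hle := (hball x hx).2
  have h5 : |(iteratedDeriv 3 J x - a * (x - xs)) * (x - xs)| ≤ a / 2 * (x - xs) ^ 2 := by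
    rw [abs_mul, ← sq_abs (x - xs), sq, ← mul_assoc]
    exact mul_le_mul_of_nonneg_right hle (abs_nonneg _)
  have h6 := (abs_le.1 h5).1
  nlinarith

section Dissipation

variable {J : ℝ → ℝ} {D : Set ℝ} {xs : ℝ} {m : ℕ} {α₁ α₂ β₁₁ β₁₂ β₂₁ β₂₂ γ₁ γ₃ : ℝ} {F : ℝ → ℝ}

theorem PolynomialLike.mul_le_neg (hJ : PolynomialLike J D xs m α₁ α₂ β₁₁ β₁₂ β₂₁ β₂₂)
    (hγ₁ : 0 ≤ γ₁) (hγ₃ : 0 ≤ γ₃)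
    (hF : ∀ x ∈ D, F x = -γ₁ * iteratedDeriv 1 J x + -γ₃ * iteratedDeriv 3 J x) :
    ∀ x ∈ D, (x - xs) * F x ≤
      -(γ₁ * β₁₁ * |x - xs| ^ m + γ₃ * β₂₁ * |x - xs| ^ (m - 2)) := fun x hx => by
  have h1 := mul_le_mul_of_nonneg_left (hJ.deriv_lower x hx) hγ₁
  have h3 := mul_le_mul_of_nonneg_left (hJ.deriv3_lower x hx) hγ₃
  rw [hF x hx]
  linarith

theorem PolynomialLike.dissipative_two (hJ : PolynomialLike J D xs 2 α₁ α₂ β₁₁ β₁₂ β₂₁ β₂₂)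
    (hγ₁ : 0 ≤ γ₁) (hγ₃ : 0 ≤ γ₃) (hpos : 0 < γ₁ * β₁₁ + γ₃ * β₂₁)
    (hF : ∀ x ∈ D, F x = -γ₁ * iteratedDeriv 1 J x + -γ₃ * iteratedDeriv 3 J x) :
    ∃ lam > 0, ∀ x ∈ D, (x - xs) * F x ≤ -lam * (x - xs) ^ 2 := by
  have hβ := hJ.β₂₁_eq_zero rfl
  refine ⟨γ₁ * β₁₁, by simpa [hβ] using hpos, fun x hx => ?_⟩
  have := hJ.mul_le_neg hγ₁ hγ₃ hF x hx
  simpa [hβ, sq_abs] using this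

/-- For quartic growth the third derivative gives the quadratic rate near `xs`; away from `xs` the
quartic bound on the first derivative dominates a quadratic one as well. -/
theorem PolynomialLike.dissipative_four (hD : IsOpen D) (hxs : xs ∈ D)
    (hJ : PolynomialLike J D xs 4 α₁ α₂ β₁₁ β₁₂ β₂₁ β₂₂)
    (hγ₁ : 0 ≤ γ₁) (hγ₃ : 0 < γ₃) (hpos : 0 < γ₁ * β₁₁ + γ₃ * β₂₁)
    (hF : ∀ x ∈ D, F x = -γ₁ * iteratedDeriv 1 J x + -γ₃ * iteratedDeriv 3 J x) :
    ∃ lam > 0, ∀ x ∈ D, (x - xs) * F x ≤ -lam * (x - xs) ^ 2 := by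
  obtain ⟨c, hc, r, hr, hcr⟩ := hJ.exists_third_deriv_lower hD hxs
  have ha : 0 ≤ γ₁ * β₁₁ := mul_nonneg hγ₁ hJ.β₁₁_nonneg
  have hb : 0 ≤ γ₃ * β₂₁ := mul_nonneg hγ₃.le hJ.β₂₁_nonneg
  have hfar : 0 < γ₁ * β₁₁ * r ^ 2 + γ₃ * β₂₁ := by
    rcases ha.lt_or_eq with h | h
    · positivity
    · rw [← h] at hpos ⊢
      linarith
  refine ⟨min (γ₃ * c) (γ₁ * β₁₁ * r ^ 2 + γ₃ * β₂₁), lt_min (by positivity) hfar,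
    fun x hx => ?_⟩
  have hy := sq_nonneg (x - xs)
  by_cases hxr : x ∈ Metric.ball xs r
  · have h1 := mul_le_mul_of_nonneg_left (hJ.deriv_lower x hx) hγ₁
    have h3 := mul_le_mul_of_nonneg_left (hcr x hxr) hγ₃.le
    have h4 := mul_le_mul_of_nonneg_right
      (min_le_left (γ₃ * c) (γ₁ * β₁₁ * r ^ 2 + γ₃ * β₂₁)) hy
    have h5 : 0 ≤ γ₁ * (β₁₁ * |x - xs| ^ 4) := by
      rw [← mul_assoc]; positivity
    rw [hF x hx]
    linarith
  · rw [Metric.mem_ball, Real.dist_eq, not_lt] at hxr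
    have h1 := hJ.mul_le_neg hγ₁ hγ₃.le hF x hx
    have h2 : r ^ 2 ≤ (x - xs) ^ 2 := by
      rw [← sq_abs (x - xs)]; exact pow_le_pow_left₀ hr.le hxr 2
    have h3 : |x - xs| ^ 4 = (x - xs) ^ 2 * (x - xs) ^ 2 := by
      rw [← sq_abs (x - xs)]; ring
    have h4 := mul_le_mul_of_nonneg_right
      (min_le_right (γ₃ * c) (γ₁ * β₁₁ * r ^ 2 + γ₃ * β₂₁)) hy
    have h5 := mul_le_mul_of_nonneg_left (mul_le_mul_of_nonneg_right h2 hy) ha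
    norm_num [h3, sq_abs] at h1
    linarith

/-- For growth of order more than `4` the decay is degenerate at `xs`, but outside every ball it
dominates a quadratic rate that depends only on the radius. -/
theorem PolynomialLike.dissipative_outside (hm : 4 < m)
    (hJ : PolynomialLike J D xs m α₁ α₂ β₁₁ β₁₂ β₂₁ β₂₂)
    (hγ₁ : 0 ≤ γ₁) (hγ₃ : 0 ≤ γ₃) (hpos : 0 < γ₁ * β₁₁ + γ₃ * β₂₁)
    (hF : ∀ x ∈ D, F x = -γ₁ * iteratedDeriv 1 J x + -γ₃ * iteratedDeriv 3 J x) :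
    ∀ r > 0, ∃ lam > 0, ∀ x ∈ D, (x - xs) * F x ≤ -lam * ((x - xs) ^ 2 - r ^ 2) := by
  intro r hr
  have ha : 0 ≤ γ₁ * β₁₁ := mul_nonneg hγ₁ hJ.β₁₁_nonneg
  have hb : 0 ≤ γ₃ * β₂₁ := mul_nonneg hγ₃ hJ.β₂₁_nonneg
  have hlam : 0 < γ₁ * β₁₁ * r ^ (m - 2) + γ₃ * β₂₁ * r ^ (m - 4) := by
    rcases ha.lt_or_eq with h | h
    · positivity
    · have hb' : 0 < γ₃ * β₂₁ := by rw [← h] at hpos; linarith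
      positivity
  refine ⟨_, hlam, fun x hx => ?_⟩
  have h1 := hJ.mul_le_neg hγ₁ hγ₃ hF x hx
  rcases le_total r |x - xs| with h | h
  · have e1 : |x - xs| ^ m = |x - xs| ^ (m - 2) * (x - xs) ^ 2 := by
      rw [← sq_abs (x - xs), ← pow_add]; congr 1; omega
    have e2 : |x - xs| ^ (m - 2) = |x - xs| ^ (m - 4) * (x - xs) ^ 2 := by
      rw [← sq_abs (x - xs), ← pow_add]; congr 1; omega
    have p1 := mul_le_mul_of_nonneg_left (mul_le_mul_of_nonneg_right
      (pow_le_pow_left₀ hr.le h (m - 2)) (sq_nonneg (x - xs))) ha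
    have p2 := mul_le_mul_of_nonneg_left (mul_le_mul_of_nonneg_right
      (pow_le_pow_left₀ hr.le h (m - 4)) (sq_nonneg (x - xs))) hb
    rw [← e1] at p1
    rw [← e2] at p2
    have p3 := mul_nonneg hlam.le (sq_nonneg r)
    linarith
  · have h2 : (x - xs) ^ 2 ≤ r ^ 2 := by
      rw [← sq_abs (x - xs)]; exact pow_le_pow_left₀ (abs_nonneg _) h 2
    have h3 : 0 ≤ γ₁ * β₁₁ * |x - xs| ^ m + γ₃ * β₂₁ * |x - xs| ^ (m - 2) := by positivity
    have h4 := mul_nonneg hlam.le (sub_nonneg.2 h2)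
    linarith

end Dissipation

theorem theorem3 (D : Set ℝ) (hD : IsOpen D) (hDc : IsConnected D) (xs : ℝ) (hxs : xs ∈ D)
    (J : ℝ → ℝ) (m : ℕ) (α₁ α₂ β₁₁ β₁₂ β₂₁ β₂₂ : ℝ)
    (hJ : PolynomialLike J D xs m α₁ α₂ β₁₁ β₁₂ β₂₁ β₂₂)
    (κ₁₂ κ₁₂₂₂ : ℤ) (hκ₁₂ : 0 < κ₁₂) (hκ₁₂₂₂ : 0 < κ₁₂₂₂)
    (hres₁ : NoResonance 4 κ₁₂ κ₁₂₂₂) (hres₃ : NoResonance 4 κ₁₂ (3 * κ₁₂₂₂))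
    (hres₄ : κ₁₂ ≠ κ₁₂₂₂ + 3 * κ₁₂₂₂)
    (g : Fin 4 → ℝ → ℝ) (hg : ∀ k, ContDiffOn ℝ 4 (g k ∘ J) D)
    (γ₁ γ₃ : ℝ) (hγ₁ : 0 ≤ γ₁) (hγ₃ : 0 ≤ γ₃)
    (hpos : 0 < γ₁ * β₁₁ + γ₃ * β₂₁) (hγ₃_four : m = 4 → 0 < γ₃)
    (hbracket₁ : ∀ x ∈ D,
      VectorField.lieBracket ℝ (g 0 ∘ J) (g 1 ∘ J) x = -γ₁ * iteratedDeriv 1 J x)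
    (hbracket₃ : ∀ x ∈ D,
      VectorField.lieBracket ℝ
        (VectorField.lieBracket ℝ (VectorField.lieBracket ℝ (g 2 ∘ J) (g 3 ∘ J)) (g 3 ∘ J))
        (g 3 ∘ J) x = -γ₃ * iteratedDeriv 3 J x) :
    (m = 2 ∨ m = 4 → PracticallyExponentiallyStable (esField g J κ₁₂ κ₁₂₂₂) D xs) ∧
      (4 < m → PracticallyAsymptoticallyStable (esField g J κ₁₂ κ₁₂₂₂) D xs) := by
  have hav := isAveragedBy_esField hD hg hκ₁₂ hκ₁₂₂₂ hres₁ hres₃ hres₄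
  have hcont := continuousOn_averagedField hD hg
  have hreg := isRegularField_esField hD hg κ₁₂ κ₁₂₂₂
  have hF : ∀ x ∈ D, averagedField (fun k => g k ∘ J) x =
      -γ₁ * iteratedDeriv 1 J x + -γ₃ * iteratedDeriv 3 J x := fun x hx =>
    congrArg₂ (· + ·) (hbracket₁ x hx) (hbracket₃ x hx)
  refine ⟨?_, fun hm => hav.practicallyAsymptoticallyStable hD hxs hcont hreg
    (hJ.dissipative_outside hm hγ₁ hγ₃ hpos hF)⟩
  rintro (rfl | rfl)
  · obtain ⟨lam, hlam, h⟩ := hJ.dissipative_two hγ₁ hγ₃ hpos hF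
    exact hav.practicallyExponentiallyStable hD hcont hreg hlam h
  · obtain ⟨lam, hlam, h⟩ := hJ.dissipative_four hD hxs hγ₁ (hγ₃_four rfl) hpos hF
    exact hav.practicallyExponentiallyStable hD hcont hreg hlam h
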